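/- Let $n\ge 0$ be an integer and let $F=\mathbb{C}(q)$, where $q$ is an indeterminate. The Hecke algebra $\mathcal{H}_n(q)$ is the unital associative $F$-algebra generated by $T_1,\dots,T_{n-1}$ subject to $T_iT_{i+1}T_i=T_{i+1}T_iT_{i+1}$ for $1\le i<n-1$, $T_iT_j=T_jT_i$ for $|i-j|>1$, and $T_i^2=(1-q)T_i+q$ for $1\le i<n$. Let $P_n=F[x_1,\dots,x_n]$, let $I_n$ be the ideal of $P_n$ generated by the symmetric polynomials without constant term, and let $R^k$ be the $k$-th homogeneous component of the coinvariant algebra $P_n/I_n$, that is, the image in $P_n/I_n$ of the homogeneous polynomials of degree $k$. Let $s_i$ (the adjacent transposition of $i$ and $i+1$) act on $P_n$ by exchanging $x_i$ and $x_{i+1}$, let $\partial_i=(x_i-x_{i+1})^{-1}(1-s_i)$ be the divided difference operator on $P_n$, let $X_i$ be multiplication by $x_i$, and let $A_i=\partial_iX_i-qX_i\partial_i$ for $1\le i<n$. The assignment $T_i\mapsto A_i$ defines a representation of $\mathcal{H}_n(q)$ on $P_n$ which preserves $I_n$ and the degree; let $\chi_1^k$ be the character of the induced representation on $R^k$. For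 $m\ge 1$ and a permutation $v\in S_m$, put $m_q(v)=(-q)^j$ if there is a unique $0\le j<m$ such that $v(1)>\dots>v(j+1)<v(j+2)<\dots<v(m)$, and $m_q(v)=0$ otherwise. For $w\in S_n$ let $\ell(w)$ be the length of a reduced expression of $w$ in the generators $s_1,\dots,s_{n-1}$. Let $\mu=(\mu_1\ge\dots\ge\mu_t)$ be a partition of $n$ and let $S_\mu=S_{\mu_1}\times\dots\times S_{\mu_t}\subseteq S_n$ be the Young subgroup, the factors acting on consecutive blocks of sizes $\mu_1,\dots,\mu_t$. Let $T_\mu\in\mathcal{H}_n(q)$ be the product $T_1T_2\cdots T_{n-1}$, in this order, with the factors $T_{\mu_1+\dots+\mu_i}$, $1\le i<t$, omitted. Every $w\in S_n$ can be written uniquely as $w=r\cdot(w_1\times\dots\times w_t)$, where $w_i\in S_{\mu_i}$ and $r$ is the element of minimal length in the left coset $wS_\mu$ (products are compositions of maps, the right factor being applied first). Put $$\mathrm{weight}_q^\mu(w)=\prod_{i=1}^t m_q(w_i).$$ **Theorem.** For every partition $\mu\vdash n$ and every $k\ge 0$, $$\chi_1^k(T_\mu)=\sum_{w\in S_n,\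 \ell(w)=k}\mathrm{weight}_q^\mu(w).$$ -/

import Mathlib

open MvPolynomial

noncomputable section

namespace HeckeCoinvariant

/-! ### The symmetric group: adjacent transpositions and length

Positions are numbered from `0`: the index `i : Fin (n - 1)` stands for the generator that the
usual notation calls `s_{i+1}`, exchanging the positions `pos i` and `posSucc i`. -/

/-- The position `i` in `Fin n`. -/
def pos {n : ℕ} (i : Fin (n - 1)) : Fin n := ⟨i, by omega⟩

/-- The position `i + 1` in `Fin n`. -/
def posSucc {n : ℕ} (i : Fin (n - 1)) : Fin n := ⟨i + 1, by omega⟩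

theorem pos_ne_posSucc {n : ℕ} (i : Fin (n - 1)) : pos i ≠ posSucc i := by
  simp [pos, posSucc, Fin.ext_iff]

/-- The Coxeter generator exchanging `i` and `i + 1`. -/
def simpleRefl {n : ℕ} (i : Fin (n - 1)) : Equiv.Perm (Fin n) := Equiv.swap (pos i) (posSucc i)

/-- The length of a permutation: the least number of factors in an expression of `w` as a product
of Coxeter generators, that is, the length of a reduced expression. -/
def length {n : ℕ} (w : Equiv.Perm (Fin n)) : ℕ :=
  sInf {m | ∃ L : List (Fin (n - 1)), L.length = m ∧ (L.map simpleRefl).prod = w}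

/-! ### Partitions, Young subgroups and weights -/

/-- A partition of `n`, listed as the weakly decreasing sequence `μ₁ ≥ μ₂ ≥ ... ≥ μ_t` of its
parts. This decomposes `Fin n` into consecutive blocks of the sizes `μ₁, ..., μ_t`. -/
def blocksOf {n : ℕ} (μ : n.Partition) : Composition n where
  blocks := μ.parts.sort (· ≥ ·)
  blocks_pos := fun {i} hi => μ.parts_pos ((Multiset.mem_sort (r := (· ≥ ·))).1 hi)
  blocks_sum := by
    rw [← Multiset.sum_coe, Multiset.sort_eq, μ.parts_sum]

/-- The embedding `S_{μ₁} × ... × S_{μ_t} → S_n`, where the `i`-th factor permutes the `i`-th block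
of consecutive positions; its image is the Young subgroup `S_μ`. -/
def youngHom {n : ℕ} (c : Composition n) :
    (∀ i : Fin c.length, Equiv.Perm (Fin (c.blocksFun i))) →* Equiv.Perm (Fin n) :=
  c.blocksFinEquiv.permCongrHom.toMonoidHom.comp
    (Equiv.Perm.sigmaCongrRightHom fun i : Fin c.length => Fin (c.blocksFun i))

/-- `r` has minimal length among the elements of its left coset `r S_μ`. -/
def IsMinimalRep {n : ℕ} (c : Composition n) (r : Equiv.Perm (Fin n)) : Prop :=
  ∀ v, length r ≤ length (r * youngHom c v)

theorem exists_minimalRep {n : ℕ} (c : Composition n) (w : Equiv.Perm (Fin n)) :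
    ∃ u, ∃ r, IsMinimalRep c r ∧ w = r * youngHom c u := by
  obtain ⟨v, hv⟩ := Finite.exists_min fun v => length (w * youngHom c v)
  refine ⟨v⁻¹, w * youngHom c v, fun v' => ?_, ?_⟩
  · rw [mul_assoc, ← map_mul]
    exact hv _
  · rw [mul_assoc, ← map_mul]
    simp

/-- The components `(w₁, ..., w_t)` in the factorization `w = r (w₁ × ... × w_t)` where `r` is the
representative of minimal length of the left coset `w S_μ`. -/
def youngComponents {n : ℕ} (c : Composition n) (w : Equiv.Perm (Fin n)) :
    ∀ i : Fin c.length, Equiv.Perm (Fin (c.blocksFun i)) :=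
  (exists_minimalRep c w).choose

/-- `w` descends `m` steps and then ascends:
`w(1) > ... > w(m+1) < w(m+2) < ... < w(n)` for some `0 ≤ m < n`. -/
def DescendsThenAscends {n : ℕ} (w : Equiv.Perm (Fin n)) (m : ℕ) : Prop :=
  m < n ∧ (∀ i j : Fin n, i < j → (j : ℕ) ≤ m → w j < w i) ∧
    ∀ i j : Fin n, m ≤ (i : ℕ) → i < j → w i < w j

open Classical in
/-- `m_q(w)`: it is `(-q)^m` if there is a unique `m` such that `w` descends `m` steps and then
ascends, and `0` if there is no such `m`. -/
def mq {F : Type*} [Field F] (q : F) {n : ℕ} (w : Equiv.Perm (Fin n)) : F :=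
  if h : ∃! m, DescendsThenAscends w m then (-q) ^ h.exists.choose else 0

/-- `weight_q^μ(w) = ∏ m_q(w_i)`. -/
def weight {F : Type*} [Field F] (q : F) {n : ℕ} (c : Composition n) (w : Equiv.Perm (Fin n)) : F :=
  ∏ i, mq q (youngComponents c w i)

/-! ### The Hecke algebra of type `A` -/

/-- The defining relations: braid relations, commutations and `T_i² = (1 - q) T_i + q`. -/
inductive HeckeRel {F : Type*} [Field F] (q : F) (n : ℕ) :
    FreeAlgebra F (Fin (n - 1)) → FreeAlgebra F (Fin (n - 1)) → Prop
  | braid (i j : Fin (n - 1)) (h : (j : ℕ) = i + 1) :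
      HeckeRel q n (FreeAlgebra.ι F i * FreeAlgebra.ι F j * FreeAlgebra.ι F i)
        (FreeAlgebra.ι F j * FreeAlgebra.ι F i * FreeAlgebra.ι F j)
  | comm (i j : Fin (n - 1)) (h : (i : ℕ) + 1 < j) :
      HeckeRel q n (FreeAlgebra.ι F i * FreeAlgebra.ι F j)
        (FreeAlgebra.ι F j * FreeAlgebra.ι F i)
  | quad (i : Fin (n - 1)) :
      HeckeRel q n (FreeAlgebra.ι F i * FreeAlgebra.ι F i)
        ((1 - q) • FreeAlgebra.ι F i + algebraMap F _ q)

/-- The Hecke algebra `H_n(q)` over `F`. -/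
abbrev HeckeAlgebra {F : Type*} [Field F] (q : F) (n : ℕ) : Type _ := RingQuot (HeckeRel q n)

/-- The generator `T_i` of the Hecke algebra. -/
def heckeT {F : Type*} [Field F] (q : F) {n : ℕ} (i : Fin (n - 1)) : HeckeAlgebra q n :=
  RingQuot.mkAlgHom F (HeckeRel q n) (FreeAlgebra.ι F i)

/-- `T_μ`: the product of the generators `T_1 T_2 ⋯ T_{n-1}` in the usual order, where the factors
`T_{μ₁ + ⋯ + μ_j}`, `1 ≤ j < t`, are omitted. -/
def heckeTmu {F : Type*} [Field F] (q : F) {n : ℕ} (c : Composition n) : HeckeAlgebra q n :=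
  (((List.finRange (n - 1)).filter fun i : Fin (n - 1) =>
    (i : ℕ) + 1 ∉ (Finset.Ico 1 c.length).image c.sizeUpTo).map (heckeT q)).prod

/-! ### Divided differences and `q`-commutators on the polynomial ring -/

/-- The action of the simple reflection `s_i` on polynomials by exchanging two variables. -/
def reflect (F : Type*) [Field F] {n : ℕ} (i : Fin (n - 1)) :
    MvPolynomial (Fin n) F →ₐ[F] MvPolynomial (Fin n) F :=
  rename (simpleRefl i)

section
variable {F : Type*} [Field F] {n : ℕ}

theorem root_ne_zero (i : Fin (n - 1)) :
    (X (pos i) - X (posSucc i) : MvPolynomial (Fin n) F) ≠ 0 :=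
  sub_ne_zero.2 fun h => pos_ne_posSucc i (X_injective h)

theorem exists_divDiff (i : Fin (n - 1)) (f : MvPolynomial (Fin n) F) :
    ∃ g, f - reflect F i f = (X (pos i) - X (posSucc i)) * g := by
  induction f using MvPolynomial.induction_on with
  | C a => exact ⟨0, by simp [reflect]⟩
  | add f g hf hg =>
    obtain ⟨a, ha⟩ := hf
    obtain ⟨b, hb⟩ := hg
    exact ⟨a + b, by rw [map_add]; linear_combination ha + hb⟩
  | mul_X f j hf =>
    obtain ⟨a, ha⟩ := hf
    have hX : ∃ b, (X j : MvPolynomial (Fin n) F) - reflect F i (X j)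
        = (X (pos i) - X (posSucc i)) * b := by
      simp only [reflect, rename_X, simpleRefl]
      by_cases h1 : j = pos i
      · subst h1
        exact ⟨1, by simp⟩
      · by_cases h2 : j = posSucc i
        · subst h2
          exact ⟨-1, by simp⟩
        · exact ⟨0, by simp [Equiv.swap_apply_of_ne_of_ne h1 h2]⟩
    obtain ⟨b, hb⟩ := hX
    exact ⟨a * X j + reflect F i f * b, by
      rw [map_mul]; linear_combination X j * ha + reflect F i f * hb⟩

/-- The value of the divided difference `(f - s_i f) / (x_i - x_{i+1})`. -/
def divDiffFun (i : Fin (n - 1)) (f : MvPolynomial (Fin n) F) : MvPolynomial (Fin n) F :=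
  (exists_divDiff i f).choose

theorem divDiffFun_spec (i : Fin (n - 1)) (f : MvPolynomial (Fin n) F) :
    (X (pos i) - X (posSucc i)) * divDiffFun i f = f - reflect F i f :=
  (exists_divDiff i f).choose_spec.symm

end

/-- The divided difference operator `∂_i = (x_i - x_{i+1})⁻¹ (1 - s_i)`. -/
def divDiff (F : Type*) [Field F] {n : ℕ} (i : Fin (n - 1)) :
    Module.End F (MvPolynomial (Fin n) F) where
  toFun := divDiffFun i
  map_add' f g := by
    apply mul_left_cancel₀ (root_ne_zero i)
    rw [mul_add, divDiffFun_spec, divDiffFun_spec, divDiffFun_spec, map_add]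
    ring
  map_smul' a f := by
    apply mul_left_cancel₀ (root_ne_zero i)
    rw [mul_smul_comm, divDiffFun_spec, RingHom.id_apply, divDiffFun_spec, map_smul, smul_sub]

/-- Multiplication by the variable `x_i`. -/
def mulX (F : Type*) [Field F] {n : ℕ} (i : Fin (n - 1)) :
    Module.End F (MvPolynomial (Fin n) F) :=
  LinearMap.mulLeft F (X (pos i))

/-- The `q`-commutator `A_i = ∂_i X_i - q X_i ∂_i`. -/
def qComm {F : Type*} [Field F] (q : F) {n : ℕ} (i : Fin (n - 1)) :
    Module.End F (MvPolynomial (Fin n) F) :=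
  divDiff F i * mulX F i - q • (mulX F i * divDiff F i)

/-- The coinvariant ideal `I_n`, generated by the symmetric polynomials without constant term. -/
def coinvIdeal (F : Type*) [Field F] (n : ℕ) : Ideal (MvPolynomial (Fin n) F) :=
  Ideal.span {f | f.IsSymmetric ∧ constantCoeff f = 0}

/-- The coinvariant algebra `P_n / I_n`. -/
abbrev CoinvAlgebra (F : Type*) [Field F] (n : ℕ) : Type _ :=
  MvPolynomial (Fin n) F ⧸ coinvIdeal F n

/-- The `k`-th homogeneous component `R^k` of the coinvariant algebra. -/
def coinvDeg (F : Type*) [Field F] (n k : ℕ) : Submodule F (CoinvAlgebra F n) :=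
  (homogeneousSubmodule (Fin n) F k).map (Ideal.Quotient.mkₐ F (coinvIdeal F n)).toLinearMap

section
variable {F : Type*} [Field F] {n : ℕ}

theorem divDiff_spec (i : Fin (n - 1)) (f : MvPolynomial (Fin n) F) :
    (X (pos i) - X (posSucc i)) * divDiff F i f = f - reflect F i f :=
  divDiffFun_spec i f

theorem reflect_X_pos (i : Fin (n - 1)) :
    reflect F i (X (pos i)) = X (posSucc i) := by
  simp [reflect, simpleRefl]

theorem reflect_X_posSucc (i : Fin (n - 1)) :
    reflect F i (X (posSucc i)) = X (pos i) := by
  simp [reflect, simpleRefl]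

theorem reflect_X_of_ne (i : Fin (n - 1)) {j : Fin n} (h1 : j ≠ pos i) (h2 : j ≠ posSucc i) :
    reflect F i (X j) = X j := by
  simp [reflect, simpleRefl, Equiv.swap_apply_of_ne_of_ne h1 h2]

theorem reflect_C (i : Fin (n - 1)) (a : F) :
    reflect F i (C a : MvPolynomial (Fin n) F) = C a := by
  simp [reflect]

theorem reflect_reflect (i : Fin (n - 1)) (f : MvPolynomial (Fin n) F) :
    reflect F i (reflect F i f) = f := by
  simp [reflect, rename_rename, simpleRefl, ← Equiv.Perm.coe_mul]

theorem qComm_eq (q : F) (i : Fin (n - 1)) (f : MvPolynomial (Fin n) F) :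
    qComm q i f = f + (X (posSucc i) - C q * X (pos i)) * divDiff F i f := by
  apply mul_left_cancel₀ (root_ne_zero i)
  have h1 := divDiff_spec i (X (pos i) * f)
  have h2 := divDiff_spec i f
  rw [map_mul (reflect F i), reflect_X_pos] at h1
  simp only [qComm, mulX, LinearMap.sub_apply, LinearMap.smul_apply, Module.End.mul_apply,
    LinearMap.mulLeft_apply, smul_eq_C_mul]
  linear_combination h1 - X (posSucc i) * h2

/-- The defining property of `A_i`, cleared of denominators. -/
theorem qComm_spec (q : F) (i : Fin (n - 1)) (f : MvPolynomial (Fin n) F) :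
    (X (pos i) - X (posSucc i)) * qComm q i f =
      (X (pos i) - X (posSucc i)) * f + (X (posSucc i) - C q * X (pos i)) * (f - reflect F i f) := by
  rw [qComm_eq, ← divDiff_spec]
  ring

theorem qComm_quad (q : F) (i : Fin (n - 1)) :
    qComm q i * qComm q i = (1 - q) • qComm q i + algebraMap F _ q := by
  refine LinearMap.ext fun f => ?_
  apply mul_left_cancel₀ (root_ne_zero i)
  apply mul_left_cancel₀ (root_ne_zero i)
  have h1 := qComm_spec q i (qComm q i f)
  have h2 := qComm_spec q i f
  have h3 := congrArg (reflect F i) h2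
  simp only [map_mul (reflect F i), map_sub (reflect F i), map_add (reflect F i), reflect_X_pos,
    reflect_X_posSucc, reflect_reflect, reflect_C] at h3
  simp only [Module.End.mul_apply, LinearMap.add_apply, LinearMap.smul_apply,
    Module.algebraMap_end_apply, smul_eq_C_mul, C_sub, C_1]
  set p : MvPolynomial (Fin n) F := X (pos i)
  set s : MvPolynomial (Fin n) F := X (posSucc i)
  linear_combination (p - s) * h1 + (s - C q * s) * h2 + (s - C q * p) * h3

theorem qComm_comm (q : F) (i j : Fin (n - 1)) (h : (i : ℕ) + 1 < j) :
    qComm q i * qComm q j = qComm q j * qComm q i := by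
  have n1 : pos j ≠ pos i := by simp only [pos, ne_eq, Fin.mk.injEq]; omega
  have n2 : pos j ≠ posSucc i := by simp only [pos, posSucc, ne_eq, Fin.mk.injEq]; omega
  have n3 : posSucc j ≠ pos i := by simp only [pos, posSucc, ne_eq, Fin.mk.injEq]; omega
  have n4 : posSucc j ≠ posSucc i := by simp only [posSucc, ne_eq, Fin.mk.injEq]; omega
  refine LinearMap.ext fun f => ?_
  apply mul_left_cancel₀ (root_ne_zero i)
  apply mul_left_cancel₀ (root_ne_zero j)
  have hc : reflect F i (reflect F j f) = reflect F j (reflect F i f) := by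
    simp only [reflect, rename_rename]
    congr 2
    have : (simpleRefl i * simpleRefl j : Equiv.Perm (Fin n)) = simpleRefl j * simpleRefl i := by
      ext x
      simp only [simpleRefl, Equiv.Perm.mul_apply, Equiv.swap_apply_def]
      grind
    simpa [Equiv.Perm.coe_mul] using congrArg DFunLike.coe this
  have h1 := qComm_spec q i (qComm q j f)
  have h2 := qComm_spec q j f
  have h3 := congrArg (reflect F i) h2
  have k1 := qComm_spec q j (qComm q i f)
  have k2 := qComm_spec q i f
  have k3 := congrArg (reflect F j) k2
  simp only [map_mul (reflect F i), map_sub (reflect F i), map_add (reflect F i),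
    reflect_X_of_ne i n1 n2, reflect_X_of_ne i n3 n4, reflect_C] at h3
  simp only [map_mul (reflect F j), map_sub (reflect F j), map_add (reflect F j),
    reflect_X_of_ne j n1.symm n3.symm, reflect_X_of_ne j n2.symm n4.symm, reflect_C] at k3
  simp only [Module.End.mul_apply]
  rw [hc] at h3
  set p : MvPolynomial (Fin n) F := X (pos i)
  set s : MvPolynomial (Fin n) F := X (posSucc i)
  set p' : MvPolynomial (Fin n) F := X (pos j)
  set s' : MvPolynomial (Fin n) F := X (posSucc j)
  linear_combination (p' - s') * h1 + (p - C q * p) * h2 - (s - C q * p) * h3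
    - ((p - s) * k1 + (p' - C q * p') * k2 - (s' - C q * p') * k3)

theorem qComm_braid (q : F) (i j : Fin (n - 1)) (h : (j : ℕ) = i + 1) :
    qComm q i * qComm q j * qComm q i = qComm q j * qComm q i * qComm q j := by
  have hp : posSucc i = pos j := by simp [pos, posSucc, h]
  have n1 : pos i ≠ pos j := by simp only [pos, ne_eq, Fin.mk.injEq]; omega
  have n2 : pos i ≠ posSucc j := by simp only [pos, posSucc, ne_eq, Fin.mk.injEq]; omega
  have n3 : pos j ≠ posSucc j := pos_ne_posSucc j
  refine LinearMap.ext fun f => ?_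
  have hbr : reflect F i (reflect F j (reflect F i f)) =
      reflect F j (reflect F i (reflect F j f)) := by
    simp only [reflect, rename_rename]
    congr 2
    have : (simpleRefl i * simpleRefl j * simpleRefl i : Equiv.Perm (Fin n)) =
        simpleRefl j * simpleRefl i * simpleRefl j := by
      ext x
      simp only [simpleRefl, hp, Equiv.Perm.mul_apply, Equiv.swap_apply_def]
      grind
    have h' := congrArg DFunLike.coe this
    simp only [Equiv.Perm.coe_mul, Function.comp_assoc] at h'
    simpa [Function.comp_assoc] using h'
  have ha1 : reflect F i (X (pos i)) = X (pos j) := by rw [reflect_X_pos, hp]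
  have hb1 : reflect F i (X (pos j)) = X (pos i) := by rw [← hp, reflect_X_posSucc]
  have hd1 : reflect F i (X (posSucc j)) = X (posSucc j) :=
    reflect_X_of_ne i n2.symm (by rw [hp]; exact n3.symm)
  have ha2 : reflect F j (X (pos i)) = X (pos i) := reflect_X_of_ne j n1 n2
  have hb2 : reflect F j (X (pos j)) = X (posSucc j) := reflect_X_pos j
  have hd2 : reflect F j (X (posSucc j)) = X (pos j) := reflect_X_posSucc j
  have r1 := root_ne_zero (F := F) i
  have r2 := root_ne_zero (F := F) j
  have r3 : (X (pos i) - X (posSucc j) : MvPolynomial (Fin n) F) ≠ 0 :=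
    sub_ne_zero.2 fun h => n2 (X_injective h)
  have s1 := qComm_spec (F := F) q i
  rw [hp] at r1 s1
  have s2 := qComm_spec (F := F) q j
  have e1 := s1 (qComm q j (qComm q i f))
  have e2 := s2 (qComm q i f)
  have e2' := congrArg (reflect F i) e2
  have e3 := s1 f
  have e31 := congrArg (reflect F i) e3
  have e32 := congrArg (reflect F j) e3
  have e312 := congrArg (reflect F i) e32
  have u1 := s2 (qComm q i (qComm q j f))
  have u2 := s1 (qComm q j f)
  have u2' := congrArg (reflect F j) u2
  have u3 := s2 f
  have u32 := congrArg (reflect F j) u3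
  have u31 := congrArg (reflect F i) u3
  have u321 := congrArg (reflect F j) u31
  simp only [map_mul (reflect F i), map_sub (reflect F i), map_add (reflect F i),
    map_mul (reflect F j), map_sub (reflect F j), map_add (reflect F j),
    ha1, hb1, hd1, ha2, hb2, hd2, reflect_C, reflect_reflect, hbr]
    at e1 e2 e2' e3 e31 e32 e312 u1 u2 u2' u3 u32 u31 u321
  simp only [Module.End.mul_apply]
  set a : MvPolynomial (Fin n) F := X (pos i)
  set b : MvPolynomial (Fin n) F := X (pos j)
  set d : MvPolynomial (Fin n) F := X (posSucc j)
  set c : MvPolynomial (Fin n) F := C q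
  apply mul_left_cancel₀ (mul_ne_zero (mul_ne_zero (pow_ne_zero 2 r1) (pow_ne_zero 2 r2)) r3)
  linear_combination (a - b) * (b - d) ^ 2 * (a - d) * e1
    + a * (1 - c) * (a - b) * (b - d) * (a - d) * e2
    - (b - c * a) * (a - b) * (b - d) ^ 2 * e2'
    + a * (1 - c) * b * (1 - c) * (b - d) * (a - d) * e3
    - a * (1 - c) * (d - c * b) * (a - b) * (b - d) * e32
    + (b - c * a) * (b - d) ^ 2 * a * (1 - c) * e31
    + (b - c * a) * (a - b) * (b - d) * (d - c * a) * e312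
    - ((b - d) * (a - b) ^ 2 * (a - d) * u1
    + b * (1 - c) * (b - d) * (a - b) * (a - d) * u2
    - (d - c * b) * (b - d) * (a - b) ^ 2 * u2'
    + b * (1 - c) * a * (1 - c) * (a - b) * (a - d) * u3
    - b * (1 - c) * (b - c * a) * (b - d) * (a - b) * u31
    + (d - c * b) * (a - b) ^ 2 * a * (1 - c) * u32
    + (d - c * b) * (b - d) * (a - b) * (d - c * a) * u321)

/-- `A_i` is linear over the polynomials that are symmetric in `x_i` and `x_{i+1}`. -/
theorem qComm_mul (q : F) (i : Fin (n - 1)) (f g : MvPolynomial (Fin n) F)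
    (hf : reflect F i f = f) : qComm q i (f * g) = f * qComm q i g := by
  apply mul_left_cancel₀ (root_ne_zero i)
  have h1 := qComm_spec q i (f * g)
  have h2 := qComm_spec q i g
  rw [map_mul (reflect F i), hf] at h1
  linear_combination h1 - f * h2

theorem qComm_mem_coinvIdeal (q : F) (i : Fin (n - 1)) (f : MvPolynomial (Fin n) F)
    (hf : f ∈ coinvIdeal F n) : qComm q i f ∈ coinvIdeal F n := by
  refine Submodule.span_induction (p := fun f _ => ∀ g, qComm q i (g * f) ∈ coinvIdeal F n)
    ?_ ?_ ?_ ?_ hf 1 |> fun h => by simpa using h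
  · intro f hf g
    rw [mul_comm, qComm_mul q i f g (hf.1 _)]
    exact Ideal.mul_mem_right _ _ (Ideal.subset_span hf)
  · intro g
    simp
  · intro f f' _ _ hf hf' g
    rw [mul_add, map_add]
    exact add_mem (hf g) (hf' g)
  · intro a f _ hf g
    rw [smul_eq_mul, ← mul_assoc]
    exact hf _

theorem divDiff_mul (i : Fin (n - 1)) (f g : MvPolynomial (Fin n) F) :
    divDiff F i (f * g) = divDiff F i f * g + reflect F i f * divDiff F i g := by
  apply mul_left_cancel₀ (root_ne_zero i)
  have h1 := divDiff_spec i (f * g)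
  have h2 := divDiff_spec i f
  have h3 := divDiff_spec i g
  rw [map_mul (reflect F i)] at h1
  linear_combination h1 - g * h2 - reflect F i f * h3

theorem divDiff_C (i : Fin (n - 1)) (a : F) :
    divDiff F i (C a : MvPolynomial (Fin n) F) = 0 := by
  apply mul_left_cancel₀ (root_ne_zero i)
  rw [divDiff_spec, reflect_C]
  simp

theorem divDiff_X (i : Fin (n - 1)) (j : Fin n) :
    ∃ a : F, divDiff F i (X j) = C a := by
  by_cases h1 : j = pos i
  · subst h1
    refine ⟨1, mul_left_cancel₀ (root_ne_zero i) ?_⟩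
    rw [divDiff_spec, reflect_X_pos]
    simp
  · by_cases h2 : j = posSucc i
    · subst h2
      refine ⟨-1, mul_left_cancel₀ (root_ne_zero i) ?_⟩
      rw [divDiff_spec, reflect_X_posSucc]
      simp
    · refine ⟨0, mul_left_cancel₀ (root_ne_zero i) ?_⟩
      rw [divDiff_spec, reflect_X_of_ne i h1 h2]
      simp

theorem X_mul_divDiff_isHomogeneous (i : Fin (n - 1)) (l : Fin n) (k : ℕ)
    (f : MvPolynomial (Fin n) F) (hf : f.IsHomogeneous k) :
    (X l * divDiff F i f).IsHomogeneous k := by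
  have key : ∀ (m : Fin n →₀ ℕ) (a : F), ∃ d, (monomial m a).IsHomogeneous d ∧
      (X l * divDiff F i (monomial m a)).IsHomogeneous d := by
    refine induction_on_monomial (fun a => ⟨0, isHomogeneous_C _ a, ?_⟩) ?_
    · rw [divDiff_C, mul_zero]
      exact isHomogeneous_zero _ _ _
    · rintro p j ⟨d, hp, hd⟩
      refine ⟨d + 1, hp.mul (isHomogeneous_X F j), ?_⟩
      obtain ⟨a, ha⟩ := divDiff_X (F := F) i j
      have hj : (reflect F i (X j)).IsHomogeneous 1 := by
        rw [reflect, rename_X]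
        exact isHomogeneous_X F _
      have h : X l * divDiff F i (p * X j) =
          reflect F i (X j) * (X l * divDiff F i p) + C a * (p * X l) := by
        rw [mul_comm p, divDiff_mul, ha]
        ring
      rw [h, add_comm d 1]
      refine (hj.mul hd).add ?_
      rw [add_comm 1 d]
      exact (hp.mul (isHomogeneous_X F l)).C_mul a
  rw [← f.support_sum_monomial_coeff, map_sum, Finset.mul_sum]
  refine IsHomogeneous.sum _ _ _ fun m hm => ?_
  obtain ⟨d, hd, hd'⟩ := key m (coeff m f)
  have hk : (monomial m (coeff m f)).IsHomogeneous k := by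
    apply isHomogeneous_monomial
    rw [hf.degree_eq_sum_deg_support hm, Finsupp.degree_apply]
  rwa [hk.inj_right hd (by simpa using hm)]

theorem qComm_isHomogeneous (q : F) (i : Fin (n - 1)) (k : ℕ)
    (f : MvPolynomial (Fin n) F) (hf : f.IsHomogeneous k) : (qComm q i f).IsHomogeneous k := by
  rw [qComm_eq, sub_mul, mul_assoc]
  exact hf.add ((X_mul_divDiff_isHomogeneous i _ k f hf).sub
    ((X_mul_divDiff_isHomogeneous i _ k f hf).C_mul q))

end

/-- The representation `ρ₁` of the Hecke algebra on `P_n`, sending `T_i` to `A_i`. -/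
def rho {F : Type*} [Field F] (q : F) (n : ℕ) :
    HeckeAlgebra q n →ₐ[F] Module.End F (MvPolynomial (Fin n) F) :=
  RingQuot.liftAlgHom F ⟨FreeAlgebra.lift F (qComm q), by
    intro a b h
    cases h with
    | braid i j h => simpa using qComm_braid q i j h
    | comm i j h => simpa using qComm_comm q i j h
    | quad i => simpa using qComm_quad q i⟩

section
variable {F : Type*} [Field F] {n : ℕ}

theorem rho_heckeT (q : F) (i : Fin (n - 1)) : rho q n (heckeT q i) = qComm q i := by
  simp [rho, heckeT]

/-- A subspace that is invariant under all `A_i` is invariant under the Hecke algebra. -/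
theorem rho_mem (q : F) (S : Submodule F (MvPolynomial (Fin n) F))
    (hS : ∀ i, ∀ f ∈ S, qComm q i f ∈ S) (h : HeckeAlgebra q n) :
    ∀ f ∈ S, rho q n h f ∈ S := by
  obtain ⟨a, rfl⟩ := RingQuot.mkAlgHom_surjective F (HeckeRel q n) h
  induction a using FreeAlgebra.induction with
  | grade0 r =>
    intro f hf
    simpa using S.smul_mem r hf
  | grade1 i =>
    intro f hf
    have := rho_heckeT q i
    rw [heckeT] at this
    rw [this]
    exact hS i f hf
  | mul a b ha hb =>
    intro f hf
    rw [map_mul, map_mul, Module.End.mul_apply]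
    exact ha _ (hb _ hf)
  | add a b ha hb =>
    intro f hf
    rw [map_add, map_add, LinearMap.add_apply]
    exact S.add_mem (ha _ hf) (hb _ hf)

theorem rho_mem_coinvIdeal (q : F) (h : HeckeAlgebra q n) (f : MvPolynomial (Fin n) F)
    (hf : f ∈ coinvIdeal F n) : rho q n h f ∈ coinvIdeal F n :=
  rho_mem q ((coinvIdeal F n).restrictScalars F) (qComm_mem_coinvIdeal q) h f hf

end

/-- The endomorphism `[f] ↦ [ρ₁(h) f]` of the coinvariant algebra. -/
def coinvMap {F : Type*} [Field F] (q : F) {n : ℕ} (h : HeckeAlgebra q n) :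
    Module.End F (CoinvAlgebra F n) :=
  (Submodule.Quotient.restrictScalarsEquiv F (coinvIdeal F n)).conj
    (((coinvIdeal F n).restrictScalars F).mapQ
      ((coinvIdeal F n).restrictScalars F) (rho q n h) (rho_mem_coinvIdeal q h))

theorem coinvMap_mk {F : Type*} [Field F] (q : F) {n : ℕ} (h : HeckeAlgebra q n)
    (f : MvPolynomial (Fin n) F) :
    coinvMap q h (Ideal.Quotient.mk (coinvIdeal F n) f) =
      Ideal.Quotient.mk (coinvIdeal F n) (rho q n h f) :=
  rfl

theorem coinv_ext {F : Type*} [Field F] {n : ℕ} {a b : Module.End F (CoinvAlgebra F n)}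
    (h : ∀ f, a (Ideal.Quotient.mk (coinvIdeal F n) f) =
      b (Ideal.Quotient.mk (coinvIdeal F n) f)) : a = b := by
  refine LinearMap.ext fun x => ?_
  obtain ⟨f, rfl⟩ := Ideal.Quotient.mk_surjective x
  exact h f

/-- The induced representation of the Hecke algebra on the coinvariant algebra. -/
def rhoCoinv {F : Type*} [Field F] (q : F) (n : ℕ) :
    HeckeAlgebra q n →ₐ[F] Module.End F (CoinvAlgebra F n) :=
  AlgHom.ofLinearMap
    { toFun := coinvMap q
      map_add' := fun a b => coinv_ext fun f => by
        simp only [LinearMap.add_apply, coinvMap_mk, map_add]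
      map_smul' := fun a b => coinv_ext fun f => by
        simp only [LinearMap.smul_apply, coinvMap_mk, map_smul, RingHom.id_apply]
        rfl }
    (coinv_ext fun f => by
      simp only [LinearMap.coe_mk, AddHom.coe_mk, coinvMap_mk, map_one, Module.End.one_apply])
    (fun a b => coinv_ext fun f => by
      simp only [LinearMap.coe_mk, AddHom.coe_mk, coinvMap_mk, map_mul, Module.End.mul_apply])

section
variable {F : Type*} [Field F] {n : ℕ}

theorem rhoCoinv_mk (q : F) (h : HeckeAlgebra q n) (f : MvPolynomial (Fin n) F) :
    rhoCoinv q n h (Ideal.Quotient.mk (coinvIdeal F n) f) =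
      Ideal.Quotient.mk (coinvIdeal F n) (rho q n h f) :=
  rfl

theorem rhoCoinv_mem_coinvDeg (q : F) (k : ℕ) (h : HeckeAlgebra q n) :
    ∀ x ∈ coinvDeg F n k, rhoCoinv q n h x ∈ coinvDeg F n k := by
  rintro _ ⟨f, hf, rfl⟩
  exact ⟨rho q n h f, rho_mem q _ (fun i f hf => qComm_isHomogeneous q i k f hf) h f hf, rfl⟩

end

/-- The character `χ₁^k` of the representation on the `k`-th homogeneous component `R^k`. -/
def chi {F : Type*} [Field F] (q : F) (n k : ℕ) (h : HeckeAlgebra q n) : F :=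
  LinearMap.trace F (coinvDeg F n k)
    ((rhoCoinv q n h).restrict (rhoCoinv_mem_coinvDeg q k h))

end HeckeCoinvariant

end

noncomputable section

namespace HeckeCoinvariant

/-! Both sides are compared through generating functions in a variable t that marks degree on the
left and length on the right. The argument works over any field F and for any q in F.

Algebraic side. The operators A_i commute with multiplication by symmetric polynomials, and P_n is
free over these with basis the reduced monomials ∏ x_i^(a_i), a_i < i, whose classes form a basis of
the coinvariant algebra. Hence the graded trace of T_μ on P_n is (∑ χ^k(T_μ) t^k) / ∏_{i≤n} (1 -
t^i) (`mk_sum_artinDiag`). The same trace is computed in the basis of monomials. On a monomial with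
exponents a, b at the places i, i+1, the diagonal coefficient of A_i is 1 if a = b, 1 - q if a > b
and 0 if a < b. Because the factors of T_μ come in increasing order, diagonal coefficients multiply
(`coeff_qComm_prod`). So only exponent vectors that decrease weakly along every block count, with a
factor 1 - q for each strict descent. Parametrized by their successive differences, they contribute
∏_{i<m} (1 - q t^i) / ∏_{i≤m} (1 - t^i) for a block of size m (`mk_sum_chainWeight_mul`).

Permutation side. Lengths add in w = r · (w_1 × ... × w_t), so the sum factors
(`sum_youngComponents`). The minimal representatives r contribute the quotient of ∏_{j≤n} (1 - t^j)
by the products ∏_{j≤m} (1 - t^j) over the blocks (`sum_minimalRep_mul`). A block of size m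
contributes ∏_{i<m} (1 - q t^i): the largest value of a permutation that descends and then ascends
stands at one of the two ends (`sum_mq_pow_numInv`). Multiplying everything out, the two sides
agree. -/

/-! ### Inversions and length -/

/-- The number of inversions of a permutation. -/
def numInv {n : ℕ} (w : Equiv.Perm (Fin n)) : ℕ :=
  ∑ x, ∑ y, if x < y ∧ w y < w x then 1 else 0

theorem simpleRefl_lt {n : ℕ} (i : Fin (n - 1)) {a b : Fin n} (h : a < b)
    (hab : ¬(a = pos i ∧ b = posSucc i)) : simpleRefl i a < simpleRefl i b := by
  simp only [simpleRefl, Equiv.swap_apply_def, pos, posSucc, Fin.ext_iff, Fin.lt_def] at *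
  split_ifs <;> first | omega | (dsimp only; omega)

theorem simpleRefl_simpleRefl {n : ℕ} (i : Fin (n - 1)) (a : Fin n) :
    simpleRefl i (simpleRefl i a) = a := by
  simp [simpleRefl]

theorem simpleRefl_mul_self {n : ℕ} (i : Fin (n - 1)) : simpleRefl i * simpleRefl i = 1 := by
  simp [simpleRefl]

theorem pos_lt_posSucc {n : ℕ} (i : Fin (n - 1)) : pos i < posSucc i := by
  simp [pos, posSucc, Fin.lt_def]

/-- An adjacent transposition keeps the relative order of every pair of positions except the one it
swaps, so reindexing the double sum by it changes a single term. -/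
theorem numInv_mul_simpleRefl {n : ℕ} (w : Equiv.Perm (Fin n)) (i : Fin (n - 1))
    (h : w (pos i) < w (posSucc i)) : numInv (w * simpleRefl i) = numInv w + 1 := by
  have hs1 : simpleRefl i (pos i) = posSucc i := by simp [simpleRefl]
  have hs2 : simpleRefl i (posSucc i) = pos i := by simp [simpleRefl]
  have e1 : numInv (w * simpleRefl i) =
      ∑ x, ∑ y, if simpleRefl i x < simpleRefl i y ∧ w y < w x then 1 else 0 := by
    rw [numInv, ← Equiv.sum_comp (simpleRefl i)]
    refine Finset.sum_congr rfl fun x _ => ?_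
    rw [← Equiv.sum_comp (simpleRefl i)]
    simp [simpleRefl_simpleRefl]
  -- After reindexing, the swapped pair appears reversed: the extra inversion sits at `x = posSucc
  -- i`, `y = pos i`.
  have e2 : ∀ x y, (if simpleRefl i x < simpleRefl i y ∧ w y < w x then 1 else 0) =
      (if x < y ∧ w y < w x then 1 else 0) +
        if x = posSucc i then (if y = pos i then 1 else 0) else 0 := by
    intro x y
    by_cases hx : x = posSucc i ∧ y = pos i
    · obtain ⟨rfl, rfl⟩ := hx
      simp [hs1, hs2, h, pos_lt_posSucc, (pos_lt_posSucc i).le]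
    · have hz : (if x = posSucc i then (if y = pos i then 1 else 0) else 0) = 0 := by
        split_ifs <;> simp_all
      rw [hz, add_zero]
      by_cases hw : w y < w x
      · have hp : ¬(x = pos i ∧ y = posSucc i) := by
          rintro ⟨rfl, rfl⟩
          exact absurd hw h.not_gt
        have : simpleRefl i x < simpleRefl i y ↔ x < y := by
          constructor
          · intro hlt
            by_contra hle
            rcases (not_lt.1 hle).eq_or_lt with rfl | hlt'
            · exact lt_irrefl _ hlt
            · exact lt_asymm hlt (simpleRefl_lt i hlt' fun hh => hx ⟨hh.2, hh.1⟩)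
          · exact fun hlt => simpleRefl_lt i hlt hp
        simp [this]
      · simp [hw]
  rw [e1, numInv]
  simp only [e2, Finset.sum_add_distrib]
  simp

theorem numInv_mul_simpleRefl_of_gt {n : ℕ} (w : Equiv.Perm (Fin n)) (i : Fin (n - 1))
    (h : w (posSucc i) < w (pos i)) : numInv (w * simpleRefl i) + 1 = numInv w := by
  have := numInv_mul_simpleRefl (w * simpleRefl i) i (by simpa [simpleRefl] using h)
  rw [← this, mul_assoc, simpleRefl_mul_self, mul_one]

theorem numInv_one {n : ℕ} : numInv (1 : Equiv.Perm (Fin n)) = 0 := by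
  simp only [numInv, Equiv.Perm.one_apply]
  refine Finset.sum_eq_zero fun x _ => Finset.sum_eq_zero fun y _ => if_neg fun h => ?_
  exact lt_asymm h.1 h.2

theorem eq_one_of_strictMono {n : ℕ} (w : Equiv.Perm (Fin n)) (h : StrictMono w) : w = 1 := by
  have := Subsingleton.elim (h.orderIsoOfSurjective w w.surjective) (OrderIso.refl _)
  ext x
  exact congrArg Fin.val (DFunLike.congr_fun this x)

theorem exists_descent {n : ℕ} (w : Equiv.Perm (Fin n)) (h : w ≠ 1) :
    ∃ i : Fin (n - 1), w (posSucc i) < w (pos i) := by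
  by_contra! hc
  apply h
  apply eq_one_of_strictMono
  cases n with
  | zero => exact fun x => x.elim0
  | succ n =>
    rw [Fin.strictMono_iff_lt_succ]
    intro i
    exact lt_of_le_of_ne (hc i) fun he => pos_ne_posSucc (n := n + 1) i (w.injective he)

/-- Upper bound for the length: multiplying by the generator at a descent removes exactly one
inversion, and only the identity has no descent. -/
theorem exists_word {n : ℕ} (w : Equiv.Perm (Fin n)) :
    ∃ L : List (Fin (n - 1)), L.length = numInv w ∧ (L.map simpleRefl).prod = w := by
  induction hm : numInv w generalizing w with
  | zero =>
    by_cases h : w = 1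
    · exact ⟨[], rfl, by simp [h]⟩
    · obtain ⟨i, hi⟩ := exists_descent w h
      have := numInv_mul_simpleRefl_of_gt w i hi
      omega
  | succ m ih =>
    have h : w ≠ 1 := by
      rintro rfl
      rw [numInv_one] at hm
      omega
    obtain ⟨i, hi⟩ := exists_descent w h
    have := numInv_mul_simpleRefl_of_gt w i hi
    obtain ⟨L, hL, hp⟩ := ih (w * simpleRefl i) (by omega)
    exact ⟨L ++ [i], by simp [hL], by simp [hp, mul_assoc, simpleRefl_mul_self]⟩

/-- Lower bound for the length: each further generator changes the number of inversions by exactly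
one. -/
theorem numInv_prod_le {n : ℕ} (L : List (Fin (n - 1))) :
    numInv (L.map simpleRefl).prod ≤ L.length := by
  induction L using List.reverseRecOn with
  | nil => simp [numInv_one]
  | append_singleton L i ih =>
    simp only [List.map_append, List.map_cons, List.map_nil, List.prod_append, List.prod_singleton,
      List.length_append, List.length_singleton]
    rcases lt_or_gt_of_ne (fun he => pos_ne_posSucc i ((L.map simpleRefl).prod.injective he))
      with h | h
    · rw [numInv_mul_simpleRefl _ i h]
      omega
    · have := numInv_mul_simpleRefl_of_gt _ i h
      omega

theorem length_eq_numInv {n : ℕ} (w : Equiv.Perm (Fin n)) : length w = numInv w := by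
  apply le_antisymm
  · exact Nat.sInf_le (exists_word w)
  · refine le_csInf ⟨_, exists_word w⟩ ?_
    rintro m ⟨L, rfl, rfl⟩
    exact numInv_prod_le L

/-! ### Minimal coset representatives -/

theorem youngHom_apply {n : ℕ} (c : Composition n)
    (v : ∀ i : Fin c.length, Equiv.Perm (Fin (c.blocksFun i))) (i : Fin c.length)
    (a : Fin (c.blocksFun i)) :
    youngHom c v (c.blocksFinEquiv ⟨i, a⟩) = c.blocksFinEquiv ⟨i, v i a⟩ := by
  simp [youngHom]

theorem blocksFinEquiv_val {n : ℕ} (c : Composition n) (i : Fin c.length)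
    (a : Fin (c.blocksFun i)) : (c.blocksFinEquiv ⟨i, a⟩ : ℕ) = c.sizeUpTo i + a :=
  c.coe_embedding i a

theorem blocksFinEquiv_lt_iff {n : ℕ} (c : Composition n) (i : Fin c.length)
    (a b : Fin (c.blocksFun i)) :
    c.blocksFinEquiv ⟨i, a⟩ < c.blocksFinEquiv ⟨i, b⟩ ↔ a < b :=
  (c.embedding i).lt_iff_lt

theorem blocksFinEquiv_lt {n : ℕ} (c : Composition n) {i j : Fin c.length} (h : i < j)
    (a : Fin (c.blocksFun i)) (b : Fin (c.blocksFun j)) :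
    c.blocksFinEquiv ⟨i, a⟩ < c.blocksFinEquiv ⟨j, b⟩ := by
  rw [Fin.lt_def, blocksFinEquiv_val, blocksFinEquiv_val]
  have h1 := c.sizeUpTo_succ' i
  have h2 : c.sizeUpTo (i + 1) ≤ c.sizeUpTo j := c.monotone_sizeUpTo h
  omega

theorem blocksFinEquiv_lt_iff_of_ne {n : ℕ} (c : Composition n) {i j : Fin c.length} (h : i ≠ j)
    (a : Fin (c.blocksFun i)) (b : Fin (c.blocksFun j)) :
    c.blocksFinEquiv ⟨i, a⟩ < c.blocksFinEquiv ⟨j, b⟩ ↔ i < j := by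
  refine ⟨fun hlt => ?_, fun h => blocksFinEquiv_lt c h a b⟩
  by_contra hle
  exact lt_asymm hlt (blocksFinEquiv_lt c (lt_of_le_of_ne (not_lt.1 hle) h.symm) b a)

theorem strictMono_of_lt_add_one {α : Type*} [Preorder α] {m : ℕ} (f : Fin m → α)
    (h : ∀ a b : Fin m, (b : ℕ) = a + 1 → f a < f b) : StrictMono f := by
  cases m with
  | zero => exact fun x => x.elim0
  | succ m =>
    rw [Fin.strictMono_iff_lt_succ]
    intro a
    exact h _ _ (by simp)

theorem exists_youngHom_eq_simpleRefl {n : ℕ} (c : Composition n) (i : Fin c.length)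
    (s : Fin (n - 1)) (a b : Fin (c.blocksFun i)) (ha : c.blocksFinEquiv ⟨i, a⟩ = pos s)
    (hb : c.blocksFinEquiv ⟨i, b⟩ = posSucc s) : ∃ v, youngHom c v = simpleRefl s := by
  classical
  refine ⟨Pi.mulSingle i (Equiv.swap a b), ?_⟩
  ext x
  obtain ⟨⟨j, y⟩, rfl⟩ := c.blocksFinEquiv.surjective x
  rw [youngHom_apply, simpleRefl, ← ha, ← hb, c.blocksFinEquiv.injective.swap_apply]
  congr 2
  by_cases hj : j = i
  · subst hj
    rw [Pi.mulSingle_eq_same]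
    simp only [Equiv.swap_apply_def]
    split_ifs <;> simp_all
  · rw [Pi.mulSingle_eq_of_ne hj, Equiv.swap_apply_of_ne_of_ne]
    · rfl
    · exact fun h => hj (congrArg Sigma.fst h)
    · exact fun h => hj (congrArg Sigma.fst h)

/-- A descent of `r` inside a block could be removed by an adjacent transposition lying in the Young
subgroup, and this would shorten `r`. -/
theorem IsMinimalRep.strictMono {n : ℕ} {c : Composition n} {r : Equiv.Perm (Fin n)}
    (hr : IsMinimalRep c r) (i : Fin c.length) :
    StrictMono fun a : Fin (c.blocksFun i) => r (c.blocksFinEquiv ⟨i, a⟩) := by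
  have key : ∀ a b : Fin (c.blocksFun i), (b : ℕ) = a + 1 →
      r (c.blocksFinEquiv ⟨i, a⟩) < r (c.blocksFinEquiv ⟨i, b⟩) := by
    intro a b hab
    have h1 := blocksFinEquiv_val c i a
    have h2 := blocksFinEquiv_val c i b
    obtain ⟨s, hs⟩ : ∃ s : Fin (n - 1), (s : ℕ) = c.sizeUpTo i + a :=
      ⟨⟨c.sizeUpTo i + a, by omega⟩, rfl⟩
    have ha : c.blocksFinEquiv ⟨i, a⟩ = pos s := Fin.ext (by simp [pos, h1, hs])
    have hb : c.blocksFinEquiv ⟨i, b⟩ = posSucc s := Fin.ext (by simp [posSucc, h2, hs]; omega)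
    obtain ⟨v, hv⟩ := exists_youngHom_eq_simpleRefl c i s a b ha hb
    rw [ha, hb]
    by_contra hle
    have hlt : r (posSucc s) < r (pos s) :=
      lt_of_le_of_ne (not_lt.1 hle) fun he => pos_ne_posSucc s (r.injective he).symm
    have h3 := numInv_mul_simpleRefl_of_gt r s hlt
    have h4 := hr v
    rw [hv, length_eq_numInv, length_eq_numInv] at h4
    omega
  exact strictMono_of_lt_add_one _ key

theorem numInv_eq_sigma {n : ℕ} (c : Composition n) (w : Equiv.Perm (Fin n)) :
    numInv w = ∑ i : Fin c.length, ∑ j : Fin c.length,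
      ∑ a : Fin (c.blocksFun i), ∑ b : Fin (c.blocksFun j),
      if c.blocksFinEquiv ⟨i, a⟩ < c.blocksFinEquiv ⟨j, b⟩ ∧
        w (c.blocksFinEquiv ⟨j, b⟩) < w (c.blocksFinEquiv ⟨i, a⟩) then 1 else 0 := by
  rw [numInv, ← Equiv.sum_comp c.blocksFinEquiv, Fintype.sum_sigma]
  refine Finset.sum_congr rfl fun i _ => ?_
  refine Eq.trans (Finset.sum_congr rfl fun a _ => ?_) Finset.sum_comm
  rw [← Equiv.sum_comp c.blocksFinEquiv, Fintype.sum_sigma]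

/-- For two different blocks, `u` only reindexes the positions inside each of them. Within one block
`r` is increasing, so the inversions there are those of `u i`. -/
theorem numInv_mul_youngHom {n : ℕ} {c : Composition n} {r : Equiv.Perm (Fin n)}
    (hr : IsMinimalRep c r) (u : ∀ i : Fin c.length, Equiv.Perm (Fin (c.blocksFun i))) :
    numInv (r * youngHom c u) = numInv r + ∑ i, numInv (u i) := by
  classical
  have key : ∀ i j, (∑ a, ∑ b, if c.blocksFinEquiv ⟨i, a⟩ < c.blocksFinEquiv ⟨j, b⟩ ∧
      (r * youngHom c u) (c.blocksFinEquiv ⟨j, b⟩) < (r * youngHom c u) (c.blocksFinEquiv ⟨i, a⟩)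
        then 1 else 0) = (∑ a, ∑ b, if c.blocksFinEquiv ⟨i, a⟩ < c.blocksFinEquiv ⟨j, b⟩ ∧
      r (c.blocksFinEquiv ⟨j, b⟩) < r (c.blocksFinEquiv ⟨i, a⟩) then 1 else 0) +
        if i = j then numInv (u i) else 0 := by
    intro i j
    simp only [Equiv.Perm.mul_apply, youngHom_apply]
    by_cases hij : i = j
    · subst hij
      simp only [blocksFinEquiv_lt_iff, (hr.strictMono i).lt_iff_lt, if_true]
      have h0 : (∑ a : Fin (c.blocksFun i), ∑ b, if a < b ∧ b < a then 1 else 0) = 0 :=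
        numInv_one
      rw [h0, zero_add, numInv]
    · simp only [blocksFinEquiv_lt_iff_of_ne c hij, if_neg hij, add_zero]
      exact (Equiv.sum_comp (u i) fun a => ∑ b, if i < j ∧ r (c.blocksFinEquiv ⟨j, u j b⟩) <
        r (c.blocksFinEquiv ⟨i, a⟩) then 1 else 0).trans (Finset.sum_congr rfl fun a _ =>
          Equiv.sum_comp (u j) fun b => if i < j ∧ r (c.blocksFinEquiv ⟨j, b⟩) <
            r (c.blocksFinEquiv ⟨i, a⟩) then 1 else 0)
  rw [numInv_eq_sigma c, numInv_eq_sigma c r]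
  simp only [key, Finset.sum_add_distrib]
  simp

/-- On each block both representatives are increasing and differ by `u' i * (u i)⁻¹`, which is
therefore increasing and hence the identity. -/
theorem youngHom_unique {n : ℕ} {c : Composition n} {r r' : Equiv.Perm (Fin n)}
    (hr : IsMinimalRep c r) (hr' : IsMinimalRep c r')
    {u u' : ∀ i : Fin c.length, Equiv.Perm (Fin (c.blocksFun i))}
    (h : r * youngHom c u = r' * youngHom c u') : u = u' := by
  funext i
  have hmono : StrictMono (u' i * (u i)⁻¹) := by
    intro a b hab
    have h' : ∀ x, r (c.blocksFinEquiv ⟨i, x⟩) =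
        r' (c.blocksFinEquiv ⟨i, (u' i * (u i)⁻¹) x⟩) := fun x => by
      have hx := congrArg (fun w => w (c.blocksFinEquiv ⟨i, (u i)⁻¹ x⟩)) h
      simpa [youngHom_apply] using hx
    have := hr.strictMono i hab
    simp only [h'] at this
    exact (hr'.strictMono i).lt_iff_lt.1 this
  have := eq_one_of_strictMono _ hmono
  exact (mul_inv_eq_one.1 this).symm

/-- Uniqueness makes the choice inside `youngComponents` harmless. -/
theorem youngComponents_mul_youngHom {n : ℕ} {c : Composition n} {r : Equiv.Perm (Fin n)}
    (hr : IsMinimalRep c r) (u : ∀ i : Fin c.length, Equiv.Perm (Fin (c.blocksFun i))) :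
    youngComponents c (r * youngHom c u) = u := by
  obtain ⟨r', hr', h⟩ := (exists_minimalRep c (r * youngHom c u)).choose_spec
  exact (youngHom_unique hr hr' h).symm

-- Unique factorization and additivity of inversions split the sum. It is used twice: with φ = 1 to
-- find the generating function of the minimal representatives, and with φ = `mq q` for the weighted
-- sum.
open Classical in
theorem sum_youngComponents {A : Type*} [CommSemiring A] {n : ℕ} (c : Composition n) (t : A)
    (φ : ∀ i : Fin c.length, Equiv.Perm (Fin (c.blocksFun i)) → A) :
    ∑ w : Equiv.Perm (Fin n), (∏ i, φ i (youngComponents c w i)) * t ^ numInv w =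
      (∑ r : Equiv.Perm (Fin n) with IsMinimalRep c r, t ^ numInv r) *
        ∏ i, ∑ v, φ i v * t ^ numInv v := by
  rw [Finset.prod_univ_sum, Finset.sum_mul_sum, ← Finset.sum_product']
  symm
  refine Finset.sum_bij (fun x _ => x.1 * youngHom c x.2) (by simp) ?_ ?_ ?_
  · rintro ⟨r, u⟩ hr ⟨r', u'⟩ hr' h
    simp only [Finset.mem_product, Finset.mem_filter, Finset.mem_univ, true_and] at hr hr'
    obtain rfl := youngHom_unique hr.1 hr'.1 h
    simpa using h
  · intro w _
    obtain ⟨u, r, hr, rfl⟩ := exists_minimalRep c w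
    exact ⟨(r, u), by simpa using hr, rfl⟩
  · rintro ⟨r, u⟩ hr
    simp only [Finset.mem_product, Finset.mem_filter, Finset.mem_univ, true_and] at hr
    simp only [youngComponents_mul_youngHom hr.1, numInv_mul_youngHom hr.1, Finset.prod_mul_distrib,
      Finset.prod_pow_eq_pow_sum, pow_add]
    ring

/-! ### Inserting the largest value -/

/-- The permutation with largest value at position `p` and pattern `σ` at the other positions. -/
def insertLast {n : ℕ} (p : Fin (n + 1)) (σ : Equiv.Perm (Fin n)) : Equiv.Perm (Fin (n + 1)) :=
  ((finSuccEquiv' p).trans (Equiv.optionCongr σ)).trans (finSuccEquiv' (Fin.last n)).symm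

theorem insertLast_self {n : ℕ} (p : Fin (n + 1)) (σ : Equiv.Perm (Fin n)) :
    insertLast p σ p = Fin.last n := by
  simp [insertLast]

theorem insertLast_succAbove {n : ℕ} (p : Fin (n + 1)) (σ : Equiv.Perm (Fin n)) (i : Fin n) :
    insertLast p σ (p.succAbove i) = (σ i).castSucc := by
  simp [insertLast]

theorem insertLast_bijective {n : ℕ} :
    Function.Bijective fun x : Fin (n + 1) × Equiv.Perm (Fin n) => insertLast x.1 x.2 := by
  rw [Fintype.bijective_iff_injective_and_card]
  constructor
  · rintro ⟨p, σ⟩ ⟨p', σ'⟩ h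
    simp only at h
    have hp : p = p' := by
      apply (insertLast p' σ').injective
      rw [insertLast_self, ← h, insertLast_self]
    subst hp
    congr 1
    ext i
    have := congrArg (fun w => (w (p.succAbove i) : ℕ)) h
    simpa [insertLast_succAbove] using this
  · simp [Fintype.card_perm, Nat.factorial_succ]

theorem sum_perm_succ {A : Type*} [AddCommMonoid A] {n : ℕ} (f : Equiv.Perm (Fin (n + 1)) → A) :
    ∑ w, f w = ∑ p, ∑ σ, f (insertLast p σ) := by
  rw [← insertLast_bijective.sum_comp, Fintype.sum_prod_type]

/-- The largest value is inverted with exactly the n - p positions to its right. -/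
theorem numInv_insertLast {n : ℕ} (p : Fin (n + 1)) (σ : Equiv.Perm (Fin n)) :
    numInv (insertLast p σ) = (n - p) + numInv σ := by
  rw [numInv, Fin.sum_univ_succAbove _ p]
  congr 1
  · rw [Fin.sum_univ_succAbove _ p]
    simp only [insertLast_self, insertLast_succAbove, lt_self_iff_false, false_and, if_false,
      zero_add, Fin.castSucc_lt_last, and_true, Fin.lt_succAbove_iff_le_castSucc]
    simp only [Fin.le_def, Fin.val_castSucc]
    rw [Fin.sum_univ_eq_sum_range fun i => if (p : ℕ) ≤ i then 1 else 0, Finset.sum_boole,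
      Nat.cast_id, ← Nat.card_Ico]
    congr 1
    ext i
    simp only [Finset.mem_filter, Finset.mem_range, Finset.mem_Ico]
    omega
  · refine Finset.sum_congr rfl fun i _ => ?_
    rw [Fin.sum_univ_succAbove _ p]
    simp only [insertLast_self, insertLast_succAbove, (Fin.le_last _).not_gt, and_false, if_false,
      zero_add, Fin.castSucc_lt_castSucc_iff, (Fin.strictMono_succAbove p).lt_iff_lt]

theorem sum_pow_numInv {A : Type*} [CommSemiring A] (t : A) (n : ℕ) :
    ∑ w : Equiv.Perm (Fin n), t ^ numInv w =
      ∏ i ∈ Finset.range n, ∑ j ∈ Finset.range (i + 1), t ^ j := by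
  induction n with
  | zero => simp [numInv]
  | succ n ih =>
    rw [Finset.prod_range_succ, ← ih, sum_perm_succ]
    simp only [numInv_insertLast, pow_add, ← Finset.mul_sum, ← Finset.sum_mul]
    rw [mul_comm, ← Finset.sum_range_reflect, Finset.sum_range]
    simp

/-! ### Permutations that descend and then ascend -/

theorem DescendsThenAscends.unique {n : ℕ} {w : Equiv.Perm (Fin n)} {m m' : ℕ}
    (h : DescendsThenAscends w m) (h' : DescendsThenAscends w m') : m = m' := by
  have key : ∀ {m m' : ℕ}, DescendsThenAscends w m → DescendsThenAscends w m' → ¬ m < m' := by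
    intro m m' h h' hlt
    exact lt_asymm (h.2.2 ⟨m, h.1⟩ ⟨m', h'.1⟩ le_rfl hlt) (h'.2.1 ⟨m, h.1⟩ ⟨m', h'.1⟩ hlt le_rfl)
  have := key h h'
  have := key h' h
  omega

section
variable {F : Type*} [Field F] (q : F)

theorem mq_eq_pow {n : ℕ} {w : Equiv.Perm (Fin n)} {m : ℕ} (h : DescendsThenAscends w m) :
    mq q w = (-q) ^ m := by
  have hu : ∃! m, DescendsThenAscends w m := ⟨m, h, fun _ h' => h'.unique h⟩
  rw [mq, dif_pos hu, hu.exists.choose_spec.unique h]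

theorem mq_eq_zero {n : ℕ} {w : Equiv.Perm (Fin n)} (h : ∀ m, ¬DescendsThenAscends w m) :
    mq q w = 0 :=
  dif_neg fun hu => h _ hu.exists.choose_spec

/-- Positivity of n matters: the empty permutation admits no `m`, whereas the permutation of one
letter admits m = 0. -/
theorem descendsThenAscends_insertLast_last {n : ℕ} (hn : 0 < n) (σ : Equiv.Perm (Fin n)) (m : ℕ) :
    DescendsThenAscends (insertLast (Fin.last n) σ) m ↔ DescendsThenAscends σ m := by
  have hs : ∀ i : Fin n, insertLast (Fin.last n) σ i.castSucc = (σ i).castSucc := fun i => by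
    rw [← insertLast_succAbove, Fin.succAbove_last]
  constructor
  · rintro ⟨h1, h2, h3⟩
    refine ⟨?_, fun i j hij hj => ?_, fun i j hi hij => ?_⟩
    · by_contra hm
      have := h2 (Fin.castSucc ⟨0, hn⟩) (Fin.last n) (Fin.castSucc_lt_last _) (by simpa using hm)
      rw [insertLast_self] at this
      exact (Fin.le_last _).not_gt this
    · simpa [hs] using h2 i.castSucc j.castSucc (by simpa using hij) (by simpa using hj)
    · simpa [hs] using h3 i.castSucc j.castSucc (by simpa using hi) (by simpa using hij)
  · rintro ⟨h1, h2, h3⟩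
    refine ⟨by omega, fun i j => ?_, fun i j => ?_⟩
    · induction j using Fin.lastCases with
      | last =>
        intro _ h
        simp only [Fin.val_last] at h
        omega
      | cast j =>
        induction i using Fin.lastCases with
        | last => exact fun h => absurd h (Fin.le_last _).not_gt
        | cast i => simpa [hs] using h2 i j
    · induction i using Fin.lastCases with
      | last => exact fun _ h => absurd h (Fin.le_last _).not_gt
      | cast i =>
        induction j using Fin.lastCases with
        | last => simp [hs, insertLast_self, Fin.castSucc_lt_last]
        | cast j => simpa [hs] using h3 i j

theorem descendsThenAscends_insertLast_zero {n : ℕ} (σ : Equiv.Perm (Fin n)) (m : ℕ) :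
    DescendsThenAscends (insertLast 0 σ) (m + 1) ↔ DescendsThenAscends σ m := by
  have hs : ∀ i : Fin n, insertLast 0 σ i.succ = (σ i).castSucc := fun i => by
    rw [← insertLast_succAbove, Fin.succAbove_zero]
  constructor
  · rintro ⟨h1, h2, h3⟩
    refine ⟨by omega, fun i j hij hj => ?_, fun i j hi hij => ?_⟩
    · simpa [hs] using h2 i.succ j.succ (by simpa using hij) (by simpa using hj)
    · simpa [hs] using h3 i.succ j.succ (by simpa using hi) (by simpa using hij)
  · rintro ⟨h1, h2, h3⟩
    refine ⟨by omega, fun i j => ?_, fun i j => ?_⟩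
    · induction j using Fin.cases with
      | zero => exact fun h => absurd h (Fin.zero_le _).not_gt
      | succ j =>
        induction i using Fin.cases with
        | zero => simp [hs, insertLast_self, Fin.castSucc_lt_last]
        | succ i => simpa [hs] using h2 i j
    · induction i using Fin.cases with
      | zero => simp
      | succ i =>
        induction j using Fin.cases with
        | zero => exact fun _ h => absurd h (Fin.zero_le _).not_gt
        | succ j => simpa [hs] using h3 i j

theorem mq_insertLast_last {n : ℕ} (hn : 0 < n) (σ : Equiv.Perm (Fin n)) :
    mq q (insertLast (Fin.last n) σ) = mq q σ := by
  by_cases h : ∃ m, DescendsThenAscends σ m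
  · obtain ⟨m, hm⟩ := h
    rw [mq_eq_pow q hm, mq_eq_pow q ((descendsThenAscends_insertLast_last hn σ m).2 hm)]
  · push Not at h
    rw [mq_eq_zero q h, mq_eq_zero q fun m hm =>
      h m ((descendsThenAscends_insertLast_last hn σ m).1 hm)]

theorem mq_insertLast_zero {n : ℕ} (hn : 0 < n) (σ : Equiv.Perm (Fin n)) :
    mq q (insertLast 0 σ) = -q * mq q σ := by
  by_cases h : ∃ m, DescendsThenAscends σ m
  · obtain ⟨m, hm⟩ := h
    rw [mq_eq_pow q hm, mq_eq_pow q ((descendsThenAscends_insertLast_zero σ m).2 hm), pow_succ']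
  · push Not at h
    rw [mq_eq_zero q h, mul_zero, mq_eq_zero q]
    -- The value m = 0 would make the whole word increasing, although its largest entry comes first
    -- and is not alone.
    rintro (_ | m) hm
    · have := hm.2.2 0 (Fin.last n) le_rfl (by simpa [Fin.lt_def] using hn)
      rw [insertLast_self] at this
      exact (Fin.le_last _).not_gt this
    · exact h m ((descendsThenAscends_insertLast_zero σ m).1 hm)

/-- A largest value strictly inside would be a peak, which a word that descends before it ascends
cannot have. -/
theorem mq_insertLast_of_ne {n : ℕ} (σ : Equiv.Perm (Fin n)) (p : Fin (n + 1)) (h0 : p ≠ 0)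
    (hl : p ≠ Fin.last n) : mq q (insertLast p σ) = 0 := by
  refine mq_eq_zero q fun m hm => ?_
  rcases le_or_gt (p : ℕ) m with h | h
  · have := hm.2.1 0 p (Fin.pos_iff_ne_zero.2 h0) h
    rw [insertLast_self] at this
    exact (Fin.le_last _).not_gt this
  · have := hm.2.2 p (Fin.last n) h.le (Fin.lt_last_iff_ne_last.2 hl)
    rw [insertLast_self] at this
    exact (Fin.le_last _).not_gt this

/-- By induction on inserting the largest value. The last place contributes the factor 1; the first
place adds one descent and n + 1 inversions, hence the factor -q t^(n+1); all other places
contribute 0. -/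
theorem sum_mq_pow_numInv {A : Type*} [CommRing A] [Algebra F A] (t : A) (n : ℕ) :
    ∑ w : Equiv.Perm (Fin (n + 1)), algebraMap F A (mq q w) * t ^ numInv w =
      ∏ i ∈ Finset.range n, (1 - algebraMap F A q * t ^ (i + 1)) := by
  induction n with
  | zero =>
    have h : ∀ w : Equiv.Perm (Fin 1), mq q w = 1 := fun w => by
      rw [mq_eq_pow q (m := 0) ⟨zero_lt_one, fun i j h => absurd h (by omega),
        fun i j _ h => absurd h (by omega)⟩, pow_zero]
    simp [h, numInv]
  | succ n ih =>
    rw [Finset.prod_range_succ, ← ih, sum_perm_succ, Fin.sum_univ_succ, Fin.sum_univ_castSucc]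
    have h0 : ∑ σ : Equiv.Perm (Fin (n + 1)), algebraMap F A (mq q (insertLast 0 σ)) *
        t ^ numInv (insertLast 0 σ) =
        -(algebraMap F A q * t ^ (n + 1)) *
          ∑ σ : Equiv.Perm (Fin (n + 1)), algebraMap F A (mq q σ) * t ^ numInv σ := by
      rw [Finset.mul_sum]
      refine Finset.sum_congr rfl fun σ _ => ?_
      rw [mq_insertLast_zero q n.succ_pos, numInv_insertLast, pow_add, map_mul, map_neg,
        Fin.val_zero, Nat.sub_zero]
      ring
    have hl : ∑ σ, algebraMap F A (mq q (insertLast (Fin.last n).succ σ)) *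
        t ^ numInv (insertLast (Fin.last n).succ σ) =
          ∑ σ : Equiv.Perm (Fin (n + 1)), algebraMap F A (mq q σ) * t ^ numInv σ := by
      refine Finset.sum_congr rfl fun σ _ => ?_
      rw [Fin.succ_last, mq_insertLast_last q n.succ_pos, numInv_insertLast, Fin.val_last,
        Nat.sub_self, zero_add]
    rw [h0, hl, Finset.sum_eq_zero (s := (Finset.univ : Finset (Fin n)))]
    · ring
    · intro p _
      refine Finset.sum_eq_zero fun σ _ => ?_
      rw [mq_insertLast_of_ne, map_zero, zero_mul]
      · exact Fin.succ_ne_zero _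
      · rw [← Fin.succ_last]
        exact fun h => (Fin.castSucc_lt_last p).ne (Fin.succ_injective _ h)

end

/-! ### Generating functions -/

section
variable {F : Type*} [Field F]

/-- The power series `∑ a(e) t^(p e)`. -/
def stretch (p : ℕ) (a : ℕ → F) : PowerSeries F :=
  PowerSeries.mk fun l => if p ∣ l then a (l / p) else 0

theorem coeff_X_pow_mul_stretch {p : ℕ} (hp : 0 < p) (a : ℕ → F) (l : ℕ) :
    PowerSeries.coeff l (PowerSeries.X ^ p * stretch p a) =
      if p ∣ l ∧ l ≠ 0 then a (l / p - 1) else 0 := by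
  rw [PowerSeries.coeff_X_pow_mul']
  by_cases hl : p ≤ l
  · obtain ⟨m, rfl⟩ := Nat.exists_eq_add_of_le hl
    have h1 : p + m ≠ 0 := by omega
    simp [stretch, PowerSeries.coeff_mk, hp, hp.ne']
  · have : ¬(p ∣ l ∧ l ≠ 0) := fun h => hl (Nat.le_of_dvd (Nat.pos_of_ne_zero h.2) h.1)
    rw [if_neg hl, if_neg this]

theorem one_sub_mul_stretch_one {p : ℕ} (hp : 0 < p) :
    (1 - PowerSeries.X ^ p) * stretch p (fun _ => (1 : F)) = 1 := by
  ext l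
  rw [sub_mul, one_mul, map_sub, coeff_X_pow_mul_stretch hp, PowerSeries.coeff_one, stretch,
    PowerSeries.coeff_mk]
  by_cases h : l = 0 <;> simp [h]

/-- The series is 1 + (1 - q)(t^p + t^(2p) + ...), which telescopes when multiplied by 1 - t^p. -/
theorem one_sub_mul_stretch {p : ℕ} (hp : 0 < p) (q : F) :
    (1 - PowerSeries.X ^ p) * stretch p (fun e => if e = 0 then 1 else 1 - q) =
      1 - algebraMap F (PowerSeries F) q * PowerSeries.X ^ p := by
  ext l
  rw [sub_mul, one_mul, map_sub, coeff_X_pow_mul_stretch hp, map_sub, PowerSeries.coeff_one, stretch,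
    PowerSeries.coeff_mk, PowerSeries.algebraMap_apply, Algebra.algebraMap_self_apply,
    PowerSeries.coeff_C_mul, PowerSeries.coeff_X_pow]
  by_cases h : l = 0
  · subst h
    simp [hp.ne]
  by_cases hd : p ∣ l
  · obtain ⟨m, rfl⟩ := hd
    have hm : m ≠ 0 := by
      rintro rfl
      simp at h
    by_cases hm1 : m = 1
    · subst hm1
      simp [hp.ne', Nat.div_self hp]
    · have : m - 1 ≠ 0 := by omega
      simp [hp.ne', Nat.mul_div_cancel_left m hp, hm, this, hm1]
  · have : l ≠ p := by
      rintro rfl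
      exact hd dvd_rfl
    simp [hd, h, this]

theorem sum_finsuppAntidiag_univ {ι A : Type*} [Fintype ι] [DecidableEq ι] [AddCommMonoid A] (d : ℕ)
    (f : (ι → ℕ) → A) :
    ∑ l ∈ Finset.finsuppAntidiag (Finset.univ : Finset ι) d, f l =
      ∑ l ∈ Finset.piAntidiag Finset.univ d, f l := by
  refine Finset.sum_nbij' (fun l => ⇑l) (fun l => Finsupp.equivFunOnFinite.symm l) ?_ ?_ ?_ ?_ ?_ <;>
    simp

theorem coeff_prod_univ {ι : Type*} [Fintype ι] [DecidableEq ι] (f : ι → PowerSeries F) (d : ℕ) :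
    PowerSeries.coeff d (∏ i, f i) =
      ∑ l ∈ Finset.piAntidiag Finset.univ d, ∏ i, PowerSeries.coeff (l i) (f i) := by
  rw [PowerSeries.coeff_prod, ← sum_finsuppAntidiag_univ d fun l => ∏ i, PowerSeries.coeff (l i) (f i)]

/-! ### Weighted chains of exponents -/

/-- The diagonal matrix coefficient of a `q`-commutator at a monomial with exponents `a`, `b`. -/
def descentWeight (q : F) (a b : ℕ) : F :=
  if a = b then 1 else if b < a then 1 - q else 0

/-- The product of the weights of all pairs of adjacent exponents. -/
def chainWeight (q : F) {m : ℕ} (α : Fin m → ℕ) : F :=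
  ∏ i : Fin (m - 1), descentWeight q (α (pos i)) (α (posSucc i))

theorem chainWeight_eq_zero (q : F) {m : ℕ} (α : Fin m → ℕ) (h : ¬Antitone α) :
    chainWeight q α = 0 := by
  rw [chainWeight, Finset.prod_eq_zero_iff]
  by_contra! hc
  apply h
  cases m with
  | zero => exact fun x => x.elim0
  | succ m =>
    rw [Fin.antitone_iff_succ_le]
    intro i
    have := hc i (Finset.mem_univ _)
    rw [descentWeight] at this
    split_ifs at this with h1 h2
    · exact h1.ge
    · exact h2.le
    · simp at this

/-- `Fin.accumulate` forms tail sums, so `s i` is counted at the i + 1 positions 0, ..., i. -/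
theorem sum_accumulate {m : ℕ} (s : Fin m → ℕ) :
    ∑ i, Fin.accumulate m m s i = ∑ i : Fin m, ((i : ℕ) + 1) * s i := by
  simp only [Fin.accumulate_apply, Finset.sum_filter]
  rw [Finset.sum_comm]
  refine Finset.sum_congr rfl fun i _ => ?_
  rw [← Finset.sum_filter, Finset.sum_const, smul_eq_mul]
  congr 1
  have h : (Finset.univ.filter fun a : Fin m => (a : ℕ) ≤ i) = Finset.Iic i := by
    ext a
    rw [Finset.mem_filter_univ, Finset.mem_Iic, Fin.le_def]
  rw [h, Fin.card_Iic]

theorem antitone_accumulate {m : ℕ} (s : Fin m → ℕ) : Antitone (Fin.accumulate m m s) := by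
  intro i j hij
  simp only [Fin.accumulate_apply]
  exact Finset.sum_le_sum_of_subset fun k hk => by
    simp only [Finset.mem_filter, Finset.mem_univ, true_and] at hk ⊢
    exact le_trans hij hk

/-- Consecutive tail sums differ by `s i`, so the chain drops strictly at `i` exactly when `s i ≠
0`. The last position has no successor, whence its factor 1. -/
theorem chainWeight_accumulate (q : F) {m : ℕ} (s : Fin m → ℕ) :
    chainWeight q (Fin.accumulate m m s) =
      ∏ i : Fin m, if (i : ℕ) + 1 < m then (if s i = 0 then 1 else 1 - q) else 1 := by
  cases m with
  | zero => rfl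
  | succ m =>
    rw [Fin.prod_univ_castSucc]
    simp only [Fin.val_last, lt_irrefl, if_false, mul_one]
    refine Finset.prod_congr rfl fun i _ => ?_
    have h : Fin.accumulate (m + 1) (m + 1) s (pos (n := m + 1) i) =
        s i.castSucc + Fin.accumulate (m + 1) (m + 1) s (posSucc (n := m + 1) i) :=
      Fin.accumulate_rec (n := m + 1) (m := m + 1) (i := i) (by omega) (by omega) s
    rw [h, descentWeight]
    simp [Nat.pos_iff_ne_zero]
    split_ifs <;> rfl

/-- A weakly decreasing vector is determined by its successive differences s_i, the last being its
final entry. Degree and weight split over the s_i, so the sum becomes a product of series in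
t^(i+1). -/
theorem mk_sum_chainWeight (q : F) (m : ℕ) :
    (PowerSeries.mk fun d => ∑ α ∈ Finset.piAntidiag (Finset.univ : Finset (Fin m)) d,
      chainWeight q α) = ∏ i : Fin m,
        stretch ((i : ℕ) + 1) fun e => if (i : ℕ) + 1 < m then (if e = 0 then 1 else 1 - q)
          else 1 := by
  classical
  ext d
  rw [PowerSeries.coeff_mk, coeff_prod_univ]
  simp only [stretch, PowerSeries.coeff_mk]
  rw [← Finset.sum_filter_add_sum_filter_not _ (fun α : Fin m → ℕ => Antitone α),
    ← Finset.sum_filter_add_sum_filter_not (Finset.piAntidiag (Finset.univ : Finset (Fin m)) d)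
      (fun l : Fin m → ℕ => ∀ i : Fin m, (i : ℕ) + 1 ∣ l i)]
  congr 1
  -- `l i = (i + 1) * s i` is the share of the total degree due to the difference `s i`.
  · refine Finset.sum_nbij' (fun α i => ((i : ℕ) + 1) * Fin.invAccumulate m m α i)
      (fun l => Fin.accumulate m m fun i => l i / ((i : ℕ) + 1)) ?_ ?_ ?_ ?_ ?_
    · intro α hα
      simp only [Finset.mem_filter, Finset.mem_piAntidiag, Finset.mem_univ, implies_true,
        and_true] at hα ⊢
      refine ⟨?_, fun i => dvd_mul_right _ _⟩
      rw [← sum_accumulate, ← hα.1]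
      exact congrArg (fun β : Fin m → ℕ => ∑ i, β i) (Fin.accumulate_invAccumulate le_rfl hα.2)
    · intro l hl
      simp only [Finset.mem_filter, Finset.mem_piAntidiag, Finset.mem_univ, implies_true,
        and_true] at hl ⊢
      refine ⟨?_, ?_⟩
      · rw [sum_accumulate, ← hl.1]
        exact Finset.sum_congr rfl fun i _ => Nat.mul_div_cancel' (hl.2 i)
      · exact antitone_accumulate _
    · intro α hα
      simp only [Finset.mem_filter] at hα
      simp only [Nat.mul_div_cancel_left _ (Nat.succ_pos _)]
      exact Fin.accumulate_invAccumulate le_rfl hα.2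
    · intro l hl
      simp only [Finset.mem_filter] at hl
      funext i
      have : Fin.invAccumulate m m (Fin.accumulate m m fun i => l i / ((i : ℕ) + 1)) =
          fun i => l i / ((i : ℕ) + 1) := by
        apply Fin.accumulate_injective le_rfl
        exact Fin.accumulate_invAccumulate le_rfl (antitone_accumulate _)
      rw [this, Nat.mul_div_cancel' (hl.2 i)]
    · intro α hα
      simp only [Finset.mem_filter] at hα
      conv_lhs => rw [← Fin.accumulate_invAccumulate le_rfl hα.2]
      rw [chainWeight_accumulate]
      simp
  -- Both remainders vanish: chains with an ascent have weight 0, and the series have no terms in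
  -- degrees not divisible by i + 1.
  · rw [Finset.sum_eq_zero, Finset.sum_eq_zero]
    · intro l hl
      simp only [Finset.mem_filter, not_forall] at hl
      obtain ⟨i, hi⟩ := hl.2
      exact Finset.prod_eq_zero (Finset.mem_univ i) (if_neg hi)
    · intro α hα
      simp only [Finset.mem_filter] at hα
      exact chainWeight_eq_zero q α hα.2

theorem mk_sum_chainWeight_mul (q : F) (m : ℕ) :
    (PowerSeries.mk fun d => ∑ α ∈ Finset.piAntidiag (Finset.univ : Finset (Fin (m + 1))) d,
      chainWeight q α) * ∏ i ∈ Finset.range (m + 1), (1 - PowerSeries.X ^ (i + 1)) =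
        ∏ i ∈ Finset.range m, (1 - algebraMap F (PowerSeries F) q * PowerSeries.X ^ (i + 1)) := by
  rw [mk_sum_chainWeight, Finset.prod_range, ← Finset.prod_mul_distrib, Fin.prod_univ_castSucc,
    Finset.prod_range]
  simp only [mul_comm (stretch _ _), Fin.val_castSucc, Fin.val_last, lt_irrefl, if_false,
    one_sub_mul_stretch_one (Nat.succ_pos _), mul_one]
  refine Finset.prod_congr rfl fun i _ => ?_
  simp only [Nat.succ_lt_succ i.2, if_true]
  exact one_sub_mul_stretch (Nat.succ_pos _) q

theorem mk_sum_prod_chainWeight (q : F) {n : ℕ} (c : Composition n) :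
    (PowerSeries.mk fun d => ∑ α ∈ Finset.piAntidiag (Finset.univ : Finset (Fin n)) d,
      ∏ i, chainWeight q fun a => α (c.blocksFinEquiv ⟨i, a⟩)) =
      ∏ i : Fin c.length, PowerSeries.mk fun d =>
        ∑ α ∈ Finset.piAntidiag (Finset.univ : Finset (Fin (c.blocksFun i))) d, chainWeight q α := by
  classical
  ext d
  rw [PowerSeries.coeff_mk, coeff_prod_univ]
  simp only [PowerSeries.coeff_mk, Finset.prod_univ_sum]
  rw [Finset.sum_sigma']
  -- The type of the second component depends on the first, so the cancellation is applied to a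
  -- function of the whole pair.
  have hE : ∀ (β : ∀ i, Fin (c.blocksFun i) → ℕ) i a,
      β (c.blocksFinEquiv.symm (c.blocksFinEquiv ⟨i, a⟩)).1
        (c.blocksFinEquiv.symm (c.blocksFinEquiv ⟨i, a⟩)).2 = β i a := fun β i a =>
    congrArg (fun s : Σ i, Fin (c.blocksFun i) => β s.1 s.2)
      (c.blocksFinEquiv.symm_apply_apply ⟨i, a⟩)
  refine Finset.sum_nbij' (fun α => ⟨fun i => ∑ a, α (c.blocksFinEquiv ⟨i, a⟩),
    fun i a => α (c.blocksFinEquiv ⟨i, a⟩)⟩)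
    (fun x y => x.2 (c.blocksFinEquiv.symm y).1 (c.blocksFinEquiv.symm y).2) ?_ ?_ ?_ ?_ ?_
  · intro α hα
    simp only [Finset.mem_sigma, Finset.mem_piAntidiag, Finset.mem_univ, implies_true, and_true,
      Fintype.mem_piFinset] at hα ⊢
    rw [← hα, ← Equiv.sum_comp c.blocksFinEquiv, Fintype.sum_sigma]
  · rintro ⟨l, β⟩ h
    simp only [Finset.mem_sigma, Finset.mem_piAntidiag, Finset.mem_univ, implies_true, and_true,
      Fintype.mem_piFinset] at h ⊢
    rw [← h.1, ← Equiv.sum_comp c.blocksFinEquiv, Fintype.sum_sigma]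
    simp [hE, ← h.2]
  · intro α _
    funext y
    simp
  · rintro ⟨l, β⟩ h
    simp only [Finset.mem_sigma, Finset.mem_piAntidiag, Finset.mem_univ, implies_true, and_true,
      Fintype.mem_piFinset] at h
    have : l = fun i => ∑ a, β i a := funext fun i => (h.2 i).symm
    subst this
    simp [hE]
  · intro α _
    rfl

end

/-! ### The polynomial ring as a module over the symmetric polynomials -/

section
variable (F : Type*) [Field F] {n : ℕ}

/-- Products of elementary symmetric polynomials and monomials `∏ x_i ^ a_i` with `a_i ≤ i`. -/
def artinElt (α : Fin n →₀ ℕ) : MvPolynomial (Fin n) F :=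
  ∏ i : Fin n, (esymm (Fin n) F ((i : ℕ) + 1) ^ (α i / ((i : ℕ) + 1)) * X i ^ (α i % ((i : ℕ) + 1)))

theorem esymm_isHomogeneous (k : ℕ) : (esymm (Fin n) F k).IsHomogeneous k := by
  rw [esymm]
  refine IsHomogeneous.sum _ _ _ fun t ht => ?_
  have := IsHomogeneous.prod t (fun i => (X i : MvPolynomial (Fin n) F)) (fun _ => 1)
    fun i _ => isHomogeneous_X F i
  simpa [(Finset.mem_powersetCard.1 ht).2] using this

/-- Division with remainder by i + 1 lets a single exponent `α i` encode both a power of the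
elementary symmetric polynomial of degree i + 1 and a reduced power of x_i, without changing the
degree. -/
theorem artinElt_isHomogeneous (α : Fin n →₀ ℕ) : (artinElt F α).IsHomogeneous α.degree := by
  rw [Finsupp.degree_eq_sum]
  refine IsHomogeneous.prod _ _ _ fun i _ => ?_
  have h := ((esymm_isHomogeneous F (n := n) ((i : ℕ) + 1)).pow (α i / ((i : ℕ) + 1))).mul
    ((isHomogeneous_X F i).pow (α i % ((i : ℕ) + 1)))
  rwa [one_mul, Nat.div_add_mod] at h

/-- The symmetric polynomials together with the variables from position `i` on generate this
subalgebra. -/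
def tailAlgebra (n i : ℕ) : Subalgebra F (MvPolynomial (Fin n) F) :=
  Algebra.adjoin F (Set.range (fun k : Fin n => esymm (Fin n) F ((k : ℕ) + 1)) ∪
    X '' {j : Fin n | i ≤ (j : ℕ)})

theorem tailAlgebra_anti {i j : ℕ} (h : i ≤ j) : tailAlgebra F n j ≤ tailAlgebra F n i :=
  Algebra.adjoin_mono (Set.union_subset_union_right _ (Set.image_mono fun _ hk => le_trans h hk))

theorem esymm_mem_tailAlgebra (i k : ℕ) (hk : k ≤ n) : esymm (Fin n) F k ∈ tailAlgebra F n i := by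
  cases k with
  | zero => simp [one_mem]
  | succ k => exact Algebra.subset_adjoin (Or.inl ⟨⟨k, hk⟩, rfl⟩)

theorem X_mem_tailAlgebra (j : Fin n) : X j ∈ tailAlgebra F n j :=
  Algebra.subset_adjoin (Or.inr ⟨j, show (j : ℕ) ≤ j from le_rfl, rfl⟩)

/-- The polynomial with roots the variables before position `i`. -/
def headPoly (n i : ℕ) : Polynomial (MvPolynomial (Fin n) F) :=
  ∏ j ∈ Finset.univ.filter (fun j : Fin n => (j : ℕ) < i), (Polynomial.X - Polynomial.C (X j))

theorem headPoly_succ (i : Fin n) :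
    headPoly F n (i + 1) = (Polynomial.X - Polynomial.C (X i)) * headPoly F n i := by
  rw [headPoly, headPoly, ← Finset.prod_insert (f := fun j : Fin n => Polynomial.X -
    Polynomial.C (X j : MvPolynomial (Fin n) F)) (by simp)]
  congr 1
  ext j
  simp only [Finset.mem_filter, Finset.mem_univ, true_and, Finset.mem_insert, Fin.ext_iff]
  omega

theorem headPoly_monic (i : ℕ) : (headPoly F n i).Monic :=
  Polynomial.monic_prod_of_monic _ _ fun _ _ => Polynomial.monic_X_sub_C _

theorem headPoly_natDegree (i : ℕ) (hi : i ≤ n) : (headPoly F n i).natDegree = i := by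
  rw [headPoly, Polynomial.natDegree_finsetProd_X_sub_C_eq_card, Fin.card_filter_val_lt,
    min_eq_right hi]

/-- The product over all variables has the coefficients ±e_k. Dividing it successively by the monic
factors X - x_j with j ≥ i stays within the subalgebra that contains these x_j. -/
theorem headPoly_mem_lifts (i : ℕ) (hi : i ≤ n) :
    headPoly F n i ∈ Polynomial.lifts (algebraMap (tailAlgebra F n i) (MvPolynomial (Fin n) F)) := by
  induction hi using Nat.decreasingInduction with
  | self =>
    have h : headPoly F n n = ((Finset.univ.val.map fun j : Fin n =>
        (X j : MvPolynomial (Fin n) F)).map fun t => Polynomial.X - Polynomial.C t).prod := by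
      rw [headPoly, Finset.filter_true_of_mem fun j _ => j.2, Multiset.map_map]
      rfl
    rw [h, Multiset.prod_X_sub_X_eq_sum_esymm]
    refine sum_mem fun j hj => mul_mem (pow_mem ?_ _) (mul_mem ?_ ?_)
    · exact (Polynomial.mem_lifts _).2 ⟨-1, by simp⟩
    · rw [← esymm_eq_multiset_esymm]
      refine Polynomial.C'_mem_lifts ⟨⟨_, esymm_mem_tailAlgebra F n j ?_⟩, rfl⟩
      simpa [Nat.lt_succ_iff] using hj
    · exact Polynomial.X_pow_mem_lifts _ _
  | of_succ i hi ih =>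
    obtain ⟨p, hp⟩ := (Polynomial.mem_lifts _).1 ih
    let x : tailAlgebra F n i := ⟨_, X_mem_tailAlgebra F ⟨i, hi⟩⟩
    let φ := Subalgebra.inclusion (tailAlgebra_anti F (n := n) (Nat.le_succ i))
    refine (Polynomial.mem_lifts _).2 ⟨p.map φ.toRingHom /ₘ (Polynomial.X - Polynomial.C x), ?_⟩
    rw [Polynomial.map_divByMonic _ (Polynomial.monic_X_sub_C _), Polynomial.map_map]
    have h1 : (algebraMap (tailAlgebra F n i) (MvPolynomial (Fin n) F)).comp φ.toRingHom =
        algebraMap (tailAlgebra F n (i + 1)) (MvPolynomial (Fin n) F) := rfl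
    rw [h1, hp, headPoly_succ F ⟨i, hi⟩]
    simp only [Polynomial.map_sub, Polynomial.map_X, Polynomial.map_C]
    exact Polynomial.mul_divByMonic_cancel_left _ (Polynomial.monic_X_sub_C _)

theorem exists_sum_of_mem_adjoin {R P : Type*} [CommRing R] [CommRing P] [Algebra R P]
    (A : Subalgebra R P) (x : P) (p : Polynomial A) (hmon : p.Monic)
    (hroot : Polynomial.aeval x p = 0) {f : P}
    (hf : f ∈ Algebra.adjoin R ((A : Set P) ∪ {x})) :
    ∃ g : ℕ → P, (∀ k, g k ∈ A) ∧ f = ∑ k ∈ Finset.range p.natDegree, g k * x ^ k := by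
  classical
  have hle : Algebra.adjoin R ((A : Set P) ∪ {x}) ≤ (Algebra.adjoin A {x}).restrictScalars R := by
    refine Algebra.adjoin_le ?_
    rintro y (hy | rfl)
    · exact Subalgebra.algebraMap_mem (Algebra.adjoin A {x}) (⟨y, hy⟩ : A)
    · exact Algebra.self_mem_adjoin_singleton A y
  have hmem : f ∈ Subalgebra.toSubmodule (Algebra.adjoin A {x}) := hle hf
  rw [← Submodule.span_range_natDegree_eq_adjoin hmon hroot, Finset.coe_image] at hmem
  obtain ⟨g, hg⟩ := (Submodule.mem_span_image_finset_iff_exists_fun _).1 hmem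
  refine ⟨fun k => if h : k ∈ Finset.range p.natDegree then g ⟨k, h⟩ else 0, fun k => ?_, ?_⟩
  · dsimp only
    split_ifs
    · exact Subtype.prop _
    · exact zero_mem _
  · rw [← hg, ← Finset.sum_coe_sort (Finset.range p.natDegree)]
    refine Finset.sum_congr rfl fun k _ => ?_
    dsimp only
    rw [dif_pos k.2]
    rfl

theorem tailAlgebra_le_adjoin (i : Fin n) : tailAlgebra F n i ≤
    Algebra.adjoin F ((tailAlgebra F n (i + 1) : Set (MvPolynomial (Fin n) F)) ∪ {X i}) := by
  refine Algebra.adjoin_le ?_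
  rintro _ (⟨k, rfl⟩ | ⟨j, hj, rfl⟩)
  · exact Algebra.subset_adjoin (Or.inl (esymm_mem_tailAlgebra F _ _ k.2))
  · rcases Nat.eq_or_lt_of_le (show (i : ℕ) ≤ j from hj) with h | h
    · rw [← Fin.ext h]
      exact Algebra.subset_adjoin (Or.inr rfl)
    · exact Algebra.subset_adjoin (Or.inl (tailAlgebra_anti F h (X_mem_tailAlgebra F j)))

/-- The variable x_i is a root of `headPoly F n (i + 1)`, which is monic of degree i + 1 over the
next smaller subalgebra, so powers of x_i up to i suffice. -/
theorem exists_sum_of_mem_tailAlgebra (i : Fin n) {f : MvPolynomial (Fin n) F}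
    (hf : f ∈ tailAlgebra F n i) :
    ∃ g : ℕ → MvPolynomial (Fin n) F, (∀ k, g k ∈ tailAlgebra F n (i + 1)) ∧
      f = ∑ k ∈ Finset.range (i + 1), g k * X i ^ k := by
  obtain ⟨p, hp⟩ := (Polynomial.mem_lifts _).1 (headPoly_mem_lifts F (n := n) (i + 1) i.2)
  have hinj : Function.Injective
    (algebraMap (tailAlgebra F n (i + 1)) (MvPolynomial (Fin n) F)) := Subtype.val_injective
  have hmon : p.Monic := by
    rw [hinj.monic_map_iff, hp]
    exact headPoly_monic F _
  have hdeg : p.natDegree = i + 1 := by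
    rw [← Polynomial.natDegree_map_eq_of_injective hinj, hp, headPoly_natDegree F _ i.2]
  have hroot : Polynomial.aeval (X i : MvPolynomial (Fin n) F) p = 0 := by
    rw [Polynomial.aeval_def, ← Polynomial.eval_map, hp, headPoly_succ]
    simp
  have h := exists_sum_of_mem_adjoin _ _ p hmon hroot (tailAlgebra_le_adjoin F i hf)
  rwa [hdeg] at h

/-- The span of the products of elementary symmetric polynomials and reduced monomials in the
variables from position `i` on. -/
def tailSpan (n i : ℕ) : Submodule F (MvPolynomial (Fin n) F) :=
  Submodule.span F (artinElt F '' {α | ∀ j : Fin n, (j : ℕ) < i → (j : ℕ) + 1 ∣ α j})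

theorem artinElt_mul_X_pow (i : Fin n) (α : Fin n →₀ ℕ) (hα : (i : ℕ) + 1 ∣ α i) (k : ℕ)
    (hk : k < (i : ℕ) + 1) :
    artinElt F α * X i ^ k = artinElt F (α + Finsupp.single i k) := by
  rw [artinElt, artinElt, ← Finset.mul_prod_erase _ _ (Finset.mem_univ i),
    ← Finset.mul_prod_erase _ _ (Finset.mem_univ i)]
  obtain ⟨b, hb⟩ := hα
  have h1 : ∀ j ∈ Finset.univ.erase i, (α + Finsupp.single i k) j = α j := fun j hj => by
    simp [(Finset.ne_of_mem_erase hj).symm]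
  have h2 : (α + Finsupp.single i k) i = ((i : ℕ) + 1) * b + k := by simp [hb]
  rw [h2, hb, Nat.mul_add_div (Nat.succ_pos _), Nat.mul_add_mod, Nat.div_eq_of_lt hk,
    Nat.mod_eq_of_lt hk, Nat.mul_div_cancel_left _ (Nat.succ_pos _), Nat.mul_mod_right]
  have h3 : ∏ j ∈ Finset.univ.erase i, (esymm (Fin n) F ((j : ℕ) + 1) ^
      ((α + Finsupp.single i k) j / ((j : ℕ) + 1)) *
        X j ^ ((α + Finsupp.single i k) j % ((j : ℕ) + 1))) =
      ∏ j ∈ Finset.univ.erase i, (esymm (Fin n) F ((j : ℕ) + 1) ^ (α j / ((j : ℕ) + 1)) *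
        X j ^ (α j % ((j : ℕ) + 1))) :=
    Finset.prod_congr rfl fun j hj => by rw [h1 j hj]
  rw [h3]
  ring

theorem artinElt_add (α β : Fin n →₀ ℕ) (hα : ∀ i : Fin n, (i : ℕ) + 1 ∣ α i) :
    artinElt F (α + β) = artinElt F α * artinElt F β := by
  rw [artinElt, artinElt, artinElt, ← Finset.prod_mul_distrib]
  refine Finset.prod_congr rfl fun i _ => ?_
  obtain ⟨b, hb⟩ := hα i
  rw [Finsupp.add_apply, hb, Nat.mul_add_div (Nat.succ_pos _), Nat.mul_add_mod,
    Nat.mul_div_cancel_left _ (Nat.succ_pos _), Nat.mul_mod_right]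
  ring

/-- The product of `k_i` times the `(i+1)`-st elementary symmetric polynomial has this index. -/
def esymmExponent (k : Fin n →₀ ℕ) : Fin n →₀ ℕ :=
  Finsupp.equivFunOnFinite.symm fun i => ((i : ℕ) + 1) * k i

theorem artinElt_esymmExponent (k : Fin n →₀ ℕ) :
    artinElt F (esymmExponent k) = ∏ i : Fin n, esymm (Fin n) F ((i : ℕ) + 1) ^ k i := by
  refine Finset.prod_congr rfl fun i _ => ?_
  simp [esymmExponent]

/-- Descending induction. At i = n only polynomials in the e_k remain; each step down adjoins powers
x_i^k with k ≤ i, which fill in the remainder of the exponent modulo i + 1. -/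
theorem tailAlgebra_le_tailSpan (i : ℕ) (hi : i ≤ n) {f : MvPolynomial (Fin n) F}
    (hf : f ∈ tailAlgebra F n i) : f ∈ tailSpan F n i := by
  induction hi using Nat.decreasingInduction generalizing f with
  | self =>
    have h0 : (X '' {j : Fin n | n ≤ (j : ℕ)} : Set (MvPolynomial (Fin n) F)) = ∅ := by
      rw [Set.image_eq_empty]
      ext j
      simp
    rw [tailAlgebra, h0, Set.union_empty, Algebra.adjoin_range_eq_range_aeval] at hf
    obtain ⟨p, rfl⟩ := (AlgHom.mem_range _).1 hf
    rw [p.as_sum, map_sum]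
    refine sum_mem fun k _ => ?_
    rw [aeval_monomial, ← Algebra.smul_def, Finsupp.prod_fintype _ _ fun _ => pow_zero _,
      ← artinElt_esymmExponent]
    exact Submodule.smul_mem _ _ (Submodule.subset_span ⟨_, fun j _ => dvd_mul_right _ _, rfl⟩)
  | of_succ i hi ih =>
    obtain ⟨g, hg, rfl⟩ := exists_sum_of_mem_tailAlgebra F ⟨i, hi⟩ hf
    refine sum_mem fun k hk => ?_
    have hk' : k < ((⟨i, hi⟩ : Fin n) : ℕ) + 1 := Finset.mem_range.1 hk
    have hle : tailSpan F n (i + 1) ≤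
        (tailSpan F n i).comap (LinearMap.mulRight F (X (⟨i, hi⟩ : Fin n) ^ k)) := by
      refine Submodule.span_le.2 ?_
      rintro _ ⟨α, hα, rfl⟩
      have hα' : ∀ j : Fin n, (j : ℕ) < i + 1 → (j : ℕ) + 1 ∣ α j := hα
      rw [SetLike.mem_coe, Submodule.mem_comap, LinearMap.mulRight_apply,
        artinElt_mul_X_pow F ⟨i, hi⟩ α (hα' ⟨i, hi⟩ (Nat.lt_succ_self i)) k hk']
      refine Submodule.subset_span ⟨_, fun j hj => ?_, rfl⟩
      have : (⟨i, hi⟩ : Fin n) ≠ j := fun h => by simp [← h] at hj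
      simpa [Finsupp.single_apply, this] using hα' j (by omega)
    exact hle (ih (hg k))

theorem span_artinElt : Submodule.span F (Set.range (artinElt F (n := n))) = ⊤ := by
  rw [eq_top_iff]
  intro f _
  have hf : f ∈ tailAlgebra F n 0 := by
    have h : tailAlgebra F n 0 = ⊤ := by
      rw [eq_top_iff, ← adjoin_range_X]
      refine Algebra.adjoin_mono ?_
      rintro _ ⟨j, rfl⟩
      exact Or.inr ⟨j, Nat.zero_le _, rfl⟩
    rw [h]
    trivial
  exact Submodule.span_mono (Set.image_subset_range _ _)
    (tailAlgebra_le_tailSpan F 0 (Nat.zero_le n) hf)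

/-! ### The Artin basis: independence from a dimension count -/

/-- The linear map sending monomials to the corresponding products of elementary symmetric
polynomials and reduced monomials. -/
def artinMap : MvPolynomial (Fin n) F →ₗ[F] MvPolynomial (Fin n) F :=
  (basisMonomials (Fin n) F).constr F (artinElt F)

theorem artinMap_monomial (α : Fin n →₀ ℕ) : artinMap F (monomial α 1) = artinElt F α := by
  have h : basisMonomials (Fin n) F α = monomial α 1 := by rw [coe_basisMonomials]
  rw [artinMap, ← h, Module.Basis.constr_basis]

theorem artinMap_surjective : Function.Surjective (artinMap F (n := n)) := by
  rw [← LinearMap.range_eq_top, artinMap, Module.Basis.constr_range, span_artinElt]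

theorem homogeneousComponent_artinMap (d : ℕ) (f : MvPolynomial (Fin n) F) :
    homogeneousComponent d (artinMap F f) = artinMap F (homogeneousComponent d f) := by
  have h : homogeneousComponent d ∘ₗ artinMap F (n := n) =
      artinMap F ∘ₗ homogeneousComponent d := by
    refine (basisMonomials (Fin n) F).ext fun α => ?_
    have h1 : (monomial α (1 : F)).IsHomogeneous α.degree :=
      isHomogeneous_monomial _ rfl
    rw [coe_basisMonomials, LinearMap.comp_apply, LinearMap.comp_apply, artinMap_monomial,
      homogeneousComponent_of_mem h1, homogeneousComponent_of_mem (artinElt_isHomogeneous F α)]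
    split_ifs
    · rw [artinMap_monomial]
    · rw [map_zero]
  exact LinearMap.congr_fun h f

theorem artinMap_isHomogeneous {d : ℕ} {f : MvPolynomial (Fin n) F} (hf : f.IsHomogeneous d) :
    (artinMap F f).IsHomogeneous d := by
  rw [← homogeneousComponent_eq_self hf, ← homogeneousComponent_artinMap]
  exact homogeneousComponent_isHomogeneous _ _

instance finite_homogeneousSubmodule (d : ℕ) : Module.Finite F (homogeneousSubmodule (Fin n) F d) :=
  Module.Finite.iff_fg.2 (homogeneousSubmodule_fg _ _ d)

/-- In each degree the map is a surjective endomorphism of a finite-dimensional space, hence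
injective. Freeness thus follows from spanning alone. -/
theorem artinMap_injective : Function.Injective (artinMap F (n := n)) := by
  rw [← LinearMap.ker_eq_bot, LinearMap.ker_eq_bot']
  intro f hf
  rw [← sum_homogeneousComponent f]
  refine Finset.sum_eq_zero fun d _ => ?_
  have hmap : ∀ g ∈ homogeneousSubmodule (Fin n) F d,
    artinMap F g ∈ homogeneousSubmodule (Fin n) F d := fun g hg => artinMap_isHomogeneous F hg
  have hs : Function.Surjective ((artinMap F).restrict hmap) := by
    rintro ⟨g, hg⟩
    obtain ⟨g', rfl⟩ := artinMap_surjective F g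
    refine ⟨⟨homogeneousComponent d g', homogeneousComponent_isHomogeneous _ _⟩, ?_⟩
    apply Subtype.ext
    rw [LinearMap.restrict_apply]
    change artinMap F _ = artinMap F g'
    rw [← homogeneousComponent_artinMap, homogeneousComponent_eq_self hg]
  have hi := LinearMap.injective_iff_surjective.2 hs
  have := @hi ⟨homogeneousComponent d f, homogeneousComponent_isHomogeneous _ _⟩ 0 (by
    apply Subtype.ext
    rw [LinearMap.restrict_apply, map_zero]
    change artinMap F _ = 0
    rw [← homogeneousComponent_artinMap, hf, map_zero])
  exact congrArg Subtype.val this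

/-- `artinMap` as a linear equivalence. -/
def artinEquiv : MvPolynomial (Fin n) F ≃ₗ[F] MvPolynomial (Fin n) F :=
  LinearEquiv.ofBijective (artinMap F) ⟨artinMap_injective F, artinMap_surjective F⟩

end

/-! ### The action of the `q`-commutators on monomials -/

section
variable {F : Type*} [Field F] {n : ℕ}

theorem divDiff_mul_of_reflect (i : Fin (n - 1)) (f g : MvPolynomial (Fin n) F)
    (hf : reflect F i f = f) : divDiff F i (f * g) = f * divDiff F i g := by
  apply mul_left_cancel₀ (root_ne_zero i)
  have h1 := divDiff_spec i (f * g)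
  have h2 := divDiff_spec i g
  rw [map_mul (reflect F i), hf] at h1
  linear_combination h1 - f * h2

theorem divDiff_X_pos_pow (i : Fin (n - 1)) (c : ℕ) :
    divDiff F i (X (pos i) ^ c) =
      ∑ j ∈ Finset.range c, X (pos i) ^ j * X (posSucc i) ^ (c - 1 - j) := by
  apply mul_left_cancel₀ (root_ne_zero i)
  rw [divDiff_spec, map_pow, reflect_X_pos, mul_comm, geom_sum₂_mul]

theorem divDiff_X_posSucc_pow (i : Fin (n - 1)) (c : ℕ) :
    divDiff F i (X (posSucc i) ^ c) =
      -∑ j ∈ Finset.range c, X (pos i) ^ j * X (posSucc i) ^ (c - 1 - j) := by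
  apply mul_left_cancel₀ (root_ne_zero i)
  rw [divDiff_spec, map_pow, reflect_X_posSucc, mul_neg, mul_comm, geom_sum₂_mul]
  ring

theorem monomial_eq_mul (i : Fin (n - 1)) (m : Fin n →₀ ℕ) (u v : ℕ) :
    monomial (m + Finsupp.single (pos i) u + Finsupp.single (posSucc i) v) (1 : F) =
      monomial m 1 * X (pos i) ^ u * X (posSucc i) ^ v := by
  rw [X_pow_eq_monomial, X_pow_eq_monomial, monomial_mul, monomial_mul, mul_one, mul_one]

theorem reflect_monomial (i : Fin (n - 1)) (m : Fin n →₀ ℕ) (hp : m (pos i) = 0)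
    (hs : m (posSucc i) = 0) : reflect F i (monomial m 1) = monomial m 1 := by
  have key : m.mapDomain (simpleRefl i) = m := by
    ext j
    have h : j = simpleRefl i (simpleRefl i j) := (simpleRefl_simpleRefl i j).symm
    rw [h, Finsupp.mapDomain_apply (simpleRefl i).injective, ← h]
    by_cases h1 : j = pos i
    · subst h1
      simp [simpleRefl, hp, hs]
    by_cases h2 : j = posSucc i
    · subst h2
      simp [simpleRefl, hp, hs]
    rw [simpleRefl, Equiv.swap_apply_of_ne_of_ne h1 h2]
  rw [reflect, rename_monomial, key]

/-- The part of the monomial symmetric in the two variables passes through the divided difference;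
what is left is x_i^c, whose divided difference is a geometric sum. -/
theorem qComm_monomial_of_ge (q : F) (i : Fin (n - 1)) (m : Fin n →₀ ℕ) (hp : m (pos i) = 0)
    (hs : m (posSucc i) = 0) (b c : ℕ) :
    qComm q i (monomial (m + Finsupp.single (pos i) (b + c) + Finsupp.single (posSucc i) b) 1) =
      monomial (m + Finsupp.single (pos i) (b + c) + Finsupp.single (posSucc i) b) 1 +
      (∑ j ∈ Finset.range c,
        monomial (m + Finsupp.single (pos i) (b + j) + Finsupp.single (posSucc i) (b + (c - j))) 1 -
      C q * ∑ j ∈ Finset.range c, monomial (m + Finsupp.single (pos i) (b + (j + 1)) +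
        Finsupp.single (posSucc i) (b + (c - 1 - j))) 1) := by
  rw [qComm_eq]
  congr 1
  simp only [monomial_eq_mul]
  have h1 : (monomial m 1 * X (pos i) ^ (b + c) * X (posSucc i) ^ b : MvPolynomial (Fin n) F) =
      (monomial m 1 * (X (pos i) * X (posSucc i)) ^ b) * X (pos i) ^ c := by ring
  have h2 : reflect F i (monomial m 1 * (X (pos i) * X (posSucc i)) ^ b) =
      monomial m 1 * (X (pos i) * X (posSucc i)) ^ b := by
    rw [map_mul, reflect_monomial i m hp hs, map_pow, map_mul, reflect_X_pos, reflect_X_posSucc,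
      mul_comm (X (posSucc i))]
  rw [h1, divDiff_mul_of_reflect i _ _ h2, divDiff_X_pos_pow, sub_mul]
  simp only [Finset.mul_sum]
  congr 1
  · refine Finset.sum_congr rfl fun j hj => ?_
    obtain ⟨e, rfl⟩ := Nat.exists_eq_add_of_lt (Finset.mem_range.1 hj)
    rw [show j + e + 1 - 1 - j = e by omega, show j + e + 1 - j = e + 1 by omega]
    ring
  · refine Finset.sum_congr rfl fun j _ => ?_
    ring

theorem qComm_monomial_of_le (q : F) (i : Fin (n - 1)) (m : Fin n →₀ ℕ) (hp : m (pos i) = 0)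
    (hs : m (posSucc i) = 0) (b c : ℕ) :
    qComm q i (monomial (m + Finsupp.single (pos i) b + Finsupp.single (posSucc i) (b + c)) 1) =
      monomial (m + Finsupp.single (pos i) b + Finsupp.single (posSucc i) (b + c)) 1 -
      (∑ j ∈ Finset.range c,
        monomial (m + Finsupp.single (pos i) (b + j) + Finsupp.single (posSucc i) (b + (c - j))) 1 -
      C q * ∑ j ∈ Finset.range c, monomial (m + Finsupp.single (pos i) (b + (j + 1)) +
        Finsupp.single (posSucc i) (b + (c - 1 - j))) 1) := by
  rw [qComm_eq]
  simp only [monomial_eq_mul]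
  have h1 : (monomial m 1 * X (pos i) ^ b * X (posSucc i) ^ (b + c) : MvPolynomial (Fin n) F) =
      (monomial m 1 * (X (pos i) * X (posSucc i)) ^ b) * X (posSucc i) ^ c := by ring
  have h2 : reflect F i (monomial m 1 * (X (pos i) * X (posSucc i)) ^ b) =
      monomial m 1 * (X (pos i) * X (posSucc i)) ^ b := by
    rw [map_mul, reflect_monomial i m hp hs, map_pow, map_mul, reflect_X_pos, reflect_X_posSucc,
      mul_comm (X (posSucc i))]
  rw [h1, divDiff_mul_of_reflect i _ _ h2, divDiff_X_posSucc_pow, mul_neg, mul_neg,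
    ← sub_eq_add_neg, sub_mul]
  simp only [Finset.mul_sum]
  congr 2
  · refine Finset.sum_congr rfl fun j hj => ?_
    obtain ⟨e, rfl⟩ := Nat.exists_eq_add_of_lt (Finset.mem_range.1 hj)
    rw [show j + e + 1 - 1 - j = e by omega, show j + e + 1 - j = e + 1 by omega]
    ring
  · refine Finset.sum_congr rfl fun j _ => ?_
    ring

theorem exists_eq_add_single (i : Fin (n - 1)) (γ : Fin n →₀ ℕ) :
    ∃ m : Fin n →₀ ℕ, m (pos i) = 0 ∧ m (posSucc i) = 0 ∧
      γ = m + Finsupp.single (pos i) (γ (pos i)) + Finsupp.single (posSucc i) (γ (posSucc i)) := by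
  refine ⟨(γ.erase (pos i)).erase (posSucc i), ?_, by simp, ?_⟩
  · simp [Finsupp.erase_apply]
  · have h := pos_ne_posSucc i
    ext j
    by_cases h1 : j = pos i
    · subst h1
      simp [h]
    by_cases h2 : j = posSucc i
    · subst h2
      simp [h.symm]
    simp [h1, h2]

/-- Exponent vectors that agree outside the positions `i`, `i + 1` and have the same sum there. -/
def SameOutside (i : Fin (n - 1)) (γ γ' : Fin n →₀ ℕ) : Prop :=
  (∀ j, j ≠ pos i → j ≠ posSucc i → γ' j = γ j) ∧
    γ' (pos i) + γ' (posSucc i) = γ (pos i) + γ (posSucc i)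

theorem coeff_add_single (i : Fin (n - 1)) (m γ' : Fin n →₀ ℕ) (u v : ℕ)
    (hp : m (pos i) = 0) (hs : m (posSucc i) = 0) :
    coeff γ' (monomial (m + Finsupp.single (pos i) u + Finsupp.single (posSucc i) v) (1 : F)) =
      if (∀ j, j ≠ pos i → j ≠ posSucc i → γ' j = m j) ∧ γ' (pos i) = u ∧ γ' (posSucc i) = v
        then 1 else 0 := by
  classical
  rw [coeff_monomial]
  congr 1
  have h := pos_ne_posSucc i
  apply propext
  constructor
  · rintro rfl
    refine ⟨fun j h1 h2 => ?_, ?_, ?_⟩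
    · simp [Ne.symm h1, Ne.symm h2]
    · simp [hp, h.symm]
    · simp [hs, h]
  · rintro ⟨h1, h2, h3⟩
    ext j
    by_cases hj1 : j = pos i
    · subst hj1
      simp [hp, h.symm, h2]
    by_cases hj2 : j = posSucc i
    · subst hj2
      simp [hs, h, h3]
    simp [h1 j hj1 hj2, Ne.symm hj1, Ne.symm hj2]

theorem coeff_qComm_monomial_eq_zero (q : F) (i : Fin (n - 1)) (γ γ' : Fin n →₀ ℕ)
    (h : ¬SameOutside i γ γ') : coeff γ' (qComm q i (monomial γ 1)) = 0 := by
  obtain ⟨m, hp, hs, hγ⟩ := exists_eq_add_single i γ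
  have h0 : ∀ u v, u + v = γ (pos i) + γ (posSucc i) → coeff γ' (monomial
      (m + Finsupp.single (pos i) u + Finsupp.single (posSucc i) v) (1 : F)) = 0 := by
    intro u v huv
    rw [coeff_add_single i m γ' u v hp hs, if_neg]
    rintro ⟨h1, h2, h3⟩
    refine h ⟨fun j hj1 hj2 => ?_, by rw [h2, h3, huv]⟩
    rw [h1 j hj1 hj2, hγ]
    simp [Ne.symm hj1, Ne.symm hj2]
  rcases le_total (γ (posSucc i)) (γ (pos i)) with hle | hle
  · obtain ⟨c, hc⟩ := Nat.exists_eq_add_of_le hle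
    rw [hγ, hc, qComm_monomial_of_ge q i m hp hs, coeff_add, coeff_sub, coeff_C_mul, coeff_sum,
      coeff_sum, h0 _ _ (by omega), Finset.sum_eq_zero, Finset.sum_eq_zero]
    · simp
    · intro j hj
      have := Finset.mem_range.1 hj
      exact h0 _ _ (by omega)
    · intro j hj
      have := Finset.mem_range.1 hj
      exact h0 _ _ (by omega)
  · obtain ⟨c, hc⟩ := Nat.exists_eq_add_of_le hle
    rw [hγ, hc, qComm_monomial_of_le q i m hp hs, coeff_sub, coeff_sub, coeff_C_mul, coeff_sum,
      coeff_sum, h0 _ _ (by omega), Finset.sum_eq_zero, Finset.sum_eq_zero]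
    · simp
    · intro j hj
      have := Finset.mem_range.1 hj
      exact h0 _ _ (by omega)
    · intro j hj
      have := Finset.mem_range.1 hj
      exact h0 _ _ (by omega)

/-- For a strict descent the monomial reappears only as the last term of the second sum, with
coefficient -q. For a strict ascent it reappears only as the first term of the subtracted first sum,
and cancels. -/
theorem coeff_qComm_monomial_self (q : F) (i : Fin (n - 1)) (γ : Fin n →₀ ℕ) :
    coeff γ (qComm q i (monomial γ 1)) = descentWeight q (γ (pos i)) (γ (posSucc i)) := by
  obtain ⟨m, hp, hs, hγ⟩ := exists_eq_add_single i γ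
  have h0 : ∀ u v, coeff γ (monomial
      (m + Finsupp.single (pos i) u + Finsupp.single (posSucc i) v) (1 : F)) =
        if γ (pos i) = u ∧ γ (posSucc i) = v then 1 else 0 := by
    intro u v
    rw [coeff_add_single i m γ u v hp hs]
    congr 1
    apply propext
    refine and_iff_right fun j hj1 hj2 => ?_
    rw [hγ]
    simp [Ne.symm hj1, Ne.symm hj2]
  rcases le_total (γ (posSucc i)) (γ (pos i)) with hle | hle
  · obtain ⟨c, hc⟩ := Nat.exists_eq_add_of_le hle
    conv_lhs => rw [hγ, hc, qComm_monomial_of_ge q i m hp hs, ← hc, ← hγ]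
    rw [coeff_add, coeff_sub, coeff_C_mul, coeff_sum, coeff_sum, coeff_monomial, if_pos rfl]
    simp only [h0, hc, descentWeight]
    cases c with
    | zero => simp
    | succ c =>
      rw [Finset.sum_eq_zero, Finset.sum_eq_single c]
      · simp
        ring
      · intro j hj hjc
        rw [if_neg]
        omega
      · simp
      · intro j hj
        have := Finset.mem_range.1 hj
        rw [if_neg]
        omega
  · obtain ⟨c, hc⟩ := Nat.exists_eq_add_of_le hle
    conv_lhs => rw [hγ, hc, qComm_monomial_of_le q i m hp hs, ← hc, ← hγ]
    rw [coeff_sub, coeff_sub, coeff_C_mul, coeff_sum, coeff_sum, coeff_monomial, if_pos rfl]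
    simp only [h0, hc, descentWeight]
    cases c with
    | zero => simp
    | succ c =>
      rw [Finset.sum_eq_single 0, Finset.sum_eq_zero]
      · simp
      · intro j hj
        rw [if_neg]
        omega
      · intro j hj hjc
        rw [if_neg]
        omega
      · simp

theorem coeff_qComm (q : F) (i : Fin (n - 1)) (f : MvPolynomial (Fin n) F) (γ' : Fin n →₀ ℕ) :
    coeff γ' (qComm q i f) = ∑ γ ∈ f.support, coeff γ f * coeff γ' (qComm q i (monomial γ 1)) := by
  conv_lhs => rw [f.as_sum, map_sum, coeff_sum]
  refine Finset.sum_congr rfl fun γ _ => ?_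
  have h : monomial γ (coeff γ f) = coeff γ f • monomial γ (1 : F) := by
    rw [smul_monomial, smul_eq_mul, mul_one]
  rw [h, map_smul, coeff_smul, smul_eq_mul]

/-! ### Diagonal coefficients of products of q-commutators -/

theorem qComm_prod_support (q : F) (α : Fin n →₀ ℕ) (r : ℕ) (L : List (Fin (n - 1)))
    (hL : ∀ i ∈ L, r ≤ (i : ℕ)) {f : MvPolynomial (Fin n) F}
    (hf : ∀ γ ∈ f.support, ∀ j : Fin n, (j : ℕ) < r → γ j = α j) :
    ∀ γ ∈ ((L.map (qComm q)).prod f).support, ∀ j : Fin n, (j : ℕ) < r → γ j = α j := by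
  induction L with
  | nil => simpa using hf
  | cons i L ih =>
    intro γ' hγ' j hj
    rw [List.map_cons, List.prod_cons, Module.End.mul_apply, mem_support_iff, coeff_qComm] at hγ'
    obtain ⟨γ, hγ, hne⟩ := Finset.exists_ne_zero_of_sum_ne_zero hγ'
    have h1 := ih (fun k hk => hL k (List.mem_cons_of_mem _ hk)) γ hγ j hj
    have h2 : SameOutside i γ γ' := by
      by_contra h
      rw [coeff_qComm_monomial_eq_zero q i γ γ' h, mul_zero] at hne
      exact hne rfl
    have h3 := hL i List.mem_cons_self
    rw [h2.1 j, h1]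
    · simp only [pos, ne_eq, Fin.ext_iff]
      omega
    · simp only [posSucc, ne_eq, Fin.ext_iff]
      omega

/-- A_i only moves exponent between the places i and i + 1. If the exponent at i already agrees with
α, preservation of the sum forces agreement at i + 1, so only γ = α contributes. -/
theorem coeff_qComm_of_support (q : F) (i : Fin (n - 1)) (α : Fin n →₀ ℕ)
    {f : MvPolynomial (Fin n) F}
    (hf : ∀ γ ∈ f.support, ∀ j : Fin n, (j : ℕ) < i + 1 → γ j = α j) :
    coeff α (qComm q i f) = descentWeight q (α (pos i)) (α (posSucc i)) * coeff α f := by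
  rw [coeff_qComm, ← coeff_qComm_monomial_self, mul_comm]
  refine Finset.sum_eq_single α (fun γ hγ hne => ?_) fun h => ?_
  · rw [coeff_qComm_monomial_eq_zero, mul_zero]
    rintro ⟨h1, h2⟩
    apply hne
    have h3 := hf γ hγ (pos i) (Nat.lt_succ_self _)
    ext j
    by_cases hj1 : j = pos i
    · rw [hj1, h3]
    by_cases hj2 : j = posSucc i
    · rw [hj2]
      omega
    exact (h1 j hj1 hj2).symm
  · rw [notMem_support_iff.1 h, zero_mul]

/-- In an increasing list the operators acting before A_i have larger indices and leave all places
up to i untouched, as `coeff_qComm_of_support` requires. -/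
theorem coeff_qComm_prod (q : F) (α : Fin n →₀ ℕ) (L : List (Fin (n - 1)))
    (hL : L.Pairwise (· < ·)) :
    coeff α ((L.map (qComm q)).prod (monomial α 1)) =
      (L.map fun i => descentWeight q (α (pos i)) (α (posSucc i))).prod := by
  classical
  induction L with
  | nil => simp
  | cons i L ih =>
    rw [List.pairwise_cons] at hL
    rw [List.map_cons, List.prod_cons, Module.End.mul_apply, coeff_qComm_of_support q i α, ih hL.2,
      List.map_cons, List.prod_cons]
    refine qComm_prod_support q α _ L (fun k hk => hL.1 k hk) ?_
    intro γ hγ j _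
    rw [support_monomial, if_neg one_ne_zero, Finset.mem_singleton] at hγ
    rw [hγ]

/-- The omitted generators are those straddling two blocks; the others correspond to the adjacent
pairs inside blocks. -/
theorem prod_blocks_chainWeight (q : F) (c : Composition n) (α : Fin n → ℕ) :
    (((List.finRange (n - 1)).filter fun i : Fin (n - 1) =>
      (i : ℕ) + 1 ∉ (Finset.Ico 1 c.length).image c.sizeUpTo).map
        fun i => descentWeight q (α (pos i)) (α (posSucc i))).prod =
      ∏ i, chainWeight q fun a => α (c.blocksFinEquiv ⟨i, a⟩) := by
  rw [← List.prod_toFinset _ ((List.nodup_finRange _).filter _), List.toFinset_filter,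
    List.toFinset_finRange]
  simp only [chainWeight, Finset.prod_sigma']
  symm
  refine Finset.prod_bij (fun x _ => ⟨c.sizeUpTo x.1 + x.2, ?_⟩) ?_ ?_ ?_ ?_
  · have h1 := c.sizeUpTo_succ' x.1
    have h2 := c.sizeUpTo_le (x.1 + 1)
    have h3 := x.2.2
    omega
  · rintro ⟨j, k⟩ _
    have h1 := c.sizeUpTo_succ' j
    have hk := k.2
    simp only [Finset.mem_filter, Finset.mem_univ, true_and, Finset.mem_image, Finset.mem_Ico,
      decide_eq_true_eq, not_exists, not_and]
    intro l hl he
    rcases Nat.lt_or_ge (j : ℕ) l with h | h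
    · have := c.monotone_sizeUpTo (show (j : ℕ) + 1 ≤ l from h)
      omega
    · have := c.monotone_sizeUpTo h
      omega
  · rintro ⟨j, k⟩ _ ⟨j', k'⟩ _ h
    simp only [Fin.mk.injEq] at h
    have h1 := c.sizeUpTo_succ' j
    have h1' := c.sizeUpTo_succ' j'
    have hk := k.2
    have hk' := k'.2
    have hj : j = j' := by
      rcases lt_trichotomy j j' with hlt | he | hlt
      · have := c.monotone_sizeUpTo (show (j : ℕ) + 1 ≤ j' from hlt)
        omega
      · exact he
      · have := c.monotone_sizeUpTo (show (j' : ℕ) + 1 ≤ j from hlt)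
        omega
    subst hj
    congr 1
    ext
    omega
  · intro i hi
    simp only [Finset.mem_filter, Finset.mem_univ, true_and, Finset.mem_image, Finset.mem_Ico,
      decide_eq_true_eq, not_exists, not_and] at hi
    have h1 := c.sizeUpTo_index_le (pos i)
    have h2 : ((pos i : Fin n) : ℕ) < c.sizeUpTo (c.index (pos i) + 1) :=
      c.lt_sizeUpTo_index_succ (pos i)
    have h3 := c.sizeUpTo_succ' (c.index (pos i))
    have h4 : ((pos i : Fin n) : ℕ) = i := rfl
    have h5 := i.2
    have h6 : (i : ℕ) + 1 ≠ c.sizeUpTo (c.index (pos i) + 1) := by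
      intro he
      have hlt := (c.index (pos i)).2
      rcases Nat.lt_or_ge ((c.index (pos i) : ℕ) + 1) c.length with h | h
      · exact hi _ ⟨by omega, h⟩ he.symm
      -- The last block ends at n, whereas i + 1 < n.
      · rw [c.sizeUpTo_ofLength_le _ h] at he
        omega
    refine ⟨⟨c.index (pos i), ⟨i - c.sizeUpTo (c.index (pos i)), by omega⟩⟩, Finset.mem_univ _, ?_⟩
    ext
    change c.sizeUpTo (c.index (pos i)) + (i - c.sizeUpTo (c.index (pos i))) = (i : ℕ)
    omega
  · rintro ⟨j, k⟩ _
    have hlt : c.sizeUpTo j + k < n - 1 := by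
      have := c.sizeUpTo_succ' j
      have := c.sizeUpTo_le (j + 1)
      omega
    have e1 : pos ⟨c.sizeUpTo j + k, hlt⟩ =
        c.blocksFinEquiv ⟨j, pos k⟩ := Fin.ext (blocksFinEquiv_val c j (pos k)).symm
    have e2 : posSucc ⟨c.sizeUpTo j + k, hlt⟩ =
        c.blocksFinEquiv ⟨j, posSucc k⟩ :=
      Fin.ext ((add_assoc _ _ _).trans (blocksFinEquiv_val c j (posSucc k)).symm)
    rw [e1, e2]

end

/-! ### Traces -/

/-- A dual family forces linear independence, so the spanning family is a basis with coordinates φ.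
-/
theorem trace_eq_sum_of_dual {F V ι : Type*} [Field F] [AddCommGroup V] [Module F V] [Fintype ι]
    [DecidableEq ι] (v : ι → V) (φ : ι → V →ₗ[F] F)
    (h : ∀ i j, φ i (v j) = if i = j then 1 else 0)
    (hs : ⊤ ≤ Submodule.span F (Set.range v)) (T : Module.End F V) :
    LinearMap.trace F V T = ∑ i, φ i (T (v i)) := by
  have hli : LinearIndependent F v := by
    rw [Fintype.linearIndependent_iff]
    intro g hg i
    have := congrArg (φ i) hg
    simpa [map_sum, h] using this
  let b := Module.Basis.mk hli hs
  have hb : ∀ i, b.coord i = φ i := fun i => b.ext fun j => by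
    rw [Module.Basis.coord_apply, Module.Basis.repr_self, Finsupp.single_apply,
      Module.Basis.mk_apply, h]
    simp [eq_comm]
  rw [LinearMap.trace_eq_matrix_trace F b, Matrix.trace]
  refine Finset.sum_congr rfl fun i _ => ?_
  rw [Matrix.diag_apply, LinearMap.toMatrix_apply, ← Module.Basis.coord_apply, hb,
    Module.Basis.mk_apply]

section
variable {F : Type*} [Field F] {n : ℕ}

theorem mem_finsuppAntidiag_univ {d : ℕ} {α : Fin n →₀ ℕ} :
    α ∈ Finset.finsuppAntidiag Finset.univ d ↔ α.degree = d := by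
  rw [Finset.mem_finsuppAntidiag, Finsupp.degree_eq_sum]
  simp

theorem isHomogeneous_mem_span {d : ℕ} {f : MvPolynomial (Fin n) F} (hf : f.IsHomogeneous d)
    {V : Type*} [AddCommGroup V] [Module F V] (S : Submodule F V) (g : MvPolynomial (Fin n) F →ₗ[F] V)
    (h : ∀ α : Fin n →₀ ℕ, α.degree = d → g (monomial α 1) ∈ S) : g f ∈ S := by
  rw [f.as_sum, map_sum]
  refine sum_mem fun α hα => ?_
  have e : monomial α (coeff α f) = coeff α f • monomial α (1 : F) := by
    rw [smul_monomial, smul_eq_mul, mul_one]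
  rw [e, map_smul]
  refine S.smul_mem _ (h α ?_)
  rw [Finsupp.degree_apply, ← hf.degree_eq_sum_deg_support hα]

theorem trace_homogeneousSubmodule (d : ℕ) (Ψ : MvPolynomial (Fin n) F ≃ₗ[F] MvPolynomial (Fin n) F)
    (hΨ : ∀ f, (Ψ f).IsHomogeneous d ↔ f.IsHomogeneous d)
    (T : Module.End F (MvPolynomial (Fin n) F))
    (hT : ∀ f ∈ homogeneousSubmodule (Fin n) F d, T f ∈ homogeneousSubmodule (Fin n) F d) :
    LinearMap.trace F _ (T.restrict hT) = ∑ α ∈ Finset.finsuppAntidiag (Finset.univ : Finset (Fin n)) d,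
      coeff α (Ψ.symm (T (Ψ (monomial α 1)))) := by
  classical
  rw [← Finset.sum_coe_sort]
  rw [trace_eq_sum_of_dual (ι := Finset.finsuppAntidiag (Finset.univ : Finset (Fin n)) d)
    (fun α => ⟨Ψ (monomial α.1 1), (hΨ _).2
      (isHomogeneous_monomial _ (mem_finsuppAntidiag_univ.1 α.2))⟩)
    (fun α => (lcoeff F α.1 ∘ₗ Ψ.symm.toLinearMap) ∘ₗ (homogeneousSubmodule (Fin n) F d).subtype)]
  · rfl
  · intro α β
    change coeff α.1 (Ψ.symm (Ψ (monomial β.1 1))) = _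
    rw [LinearEquiv.symm_apply_apply, coeff_monomial]
    exact if_congr (by rw [Subtype.ext_iff, eq_comm]) rfl rfl
  · rintro ⟨f, hf⟩ _
    have hg : (Ψ.symm f).IsHomogeneous d := by
      rw [← hΨ, LinearEquiv.apply_symm_apply]
      exact hf
    have hmem := isHomogeneous_mem_span hg ((Submodule.span F (Set.range
      fun α : Finset.finsuppAntidiag (Finset.univ : Finset (Fin n)) d =>
        (⟨Ψ (monomial α.1 1), (hΨ _).2 (isHomogeneous_monomial _ (mem_finsuppAntidiag_univ.1 α.2))⟩ :
          homogeneousSubmodule (Fin n) F d))).map (homogeneousSubmodule (Fin n) F d).subtype)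
      Ψ.toLinearMap fun α hα => ⟨_, Submodule.subset_span
        ⟨⟨α, mem_finsuppAntidiag_univ.2 hα⟩, rfl⟩, rfl⟩
    obtain ⟨y, hy, he⟩ := hmem
    have hy' : y = ⟨f, hf⟩ := Subtype.ext (he.trans (Ψ.apply_symm_apply f))
    rwa [hy'] at hy

theorem artinEquiv_apply (f : MvPolynomial (Fin n) F) : artinEquiv F f = artinMap F f := rfl

theorem artinEquiv_isHomogeneous_iff (d : ℕ) (f : MvPolynomial (Fin n) F) :
    (artinEquiv F f).IsHomogeneous d ↔ f.IsHomogeneous d := by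
  refine ⟨fun h => ?_, fun h => artinMap_isHomogeneous F h⟩
  have h1 := homogeneousComponent_artinMap F d f
  rw [← artinEquiv_apply, homogeneousComponent_eq_self h, artinEquiv_apply] at h1
  rw [artinMap_injective F h1]
  exact homogeneousComponent_isHomogeneous _ _

theorem rho_isHomogeneous (q : F) (h : HeckeAlgebra q n) (d : ℕ) :
    ∀ f ∈ homogeneousSubmodule (Fin n) F d, rho q n h f ∈ homogeneousSubmodule (Fin n) F d :=
  rho_mem q _ (fun i f hf => qComm_isHomogeneous q i d f hf) h

theorem rho_symmetric_mul (q : F) (h : HeckeAlgebra q n) (s : MvPolynomial (Fin n) F)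
    (hs : s.IsSymmetric) : ∀ f, rho q n h (s * f) = s * rho q n h f := by
  obtain ⟨a, rfl⟩ := RingQuot.mkAlgHom_surjective F (HeckeRel q n) h
  induction a using FreeAlgebra.induction with
  | grade0 r => simp
  | grade1 i =>
    intro f
    have := rho_heckeT q i
    rw [heckeT] at this
    rw [this]
    exact qComm_mul q i s f (hs _)
  | mul a b ha hb =>
    intro f
    rw [map_mul (RingQuot.mkAlgHom F (HeckeRel q n)), map_mul (rho q n),
      Module.End.mul_apply, hb, ha, Module.End.mul_apply]
  | add a b ha hb =>
    intro f
    rw [map_add, map_add, LinearMap.add_apply, ha, hb, LinearMap.add_apply, mul_add]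

/-! ### Splitting exponents into divisible and reduced parts -/

/-- Exponents of products of elementary symmetric polynomials. -/
def IsDivisible (α : Fin n →₀ ℕ) : Prop := ∀ i : Fin n, (i : ℕ) + 1 ∣ α i

/-- Exponents of reduced monomials. -/
def IsReduced (α : Fin n →₀ ℕ) : Prop := ∀ i : Fin n, α i < (i : ℕ) + 1

/-- The reduced part of an exponent. -/
def reducedPart (α : Fin n →₀ ℕ) : Fin n →₀ ℕ :=
  Finsupp.equivFunOnFinite.symm fun i => α i % ((i : ℕ) + 1)

theorem isReduced_reducedPart (α : Fin n →₀ ℕ) : IsReduced (reducedPart α) :=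
  fun _ => Nat.mod_lt _ (Nat.succ_pos _)

theorem reducedPart_le (α : Fin n →₀ ℕ) : reducedPart α ≤ α := fun _ => Nat.mod_le _ _

theorem isDivisible_sub_reducedPart (α : Fin n →₀ ℕ) : IsDivisible (α - reducedPart α) :=
  fun _ => Nat.dvd_sub_mod _

theorem reducedPart_add {α β : Fin n →₀ ℕ} (hα : IsDivisible α) (hβ : IsReduced β) :
    reducedPart (α + β) = β := by
  ext i
  obtain ⟨b, hb⟩ := hα i
  change (α i + β i) % _ = _
  rw [hb, Nat.mul_add_mod, Nat.mod_eq_of_lt (hβ i)]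

theorem isReduced_iff (α : Fin n →₀ ℕ) : IsReduced α ↔ α - reducedPart α = 0 := by
  constructor
  · intro h
    ext i
    change α i - α i % _ = 0
    rw [Nat.mod_eq_of_lt (h i), Nat.sub_self]
  · intro h i
    have := DFunLike.congr_fun h i
    change α i - α i % _ = 0 at this
    have h2 := Nat.mod_lt (α i) (Nat.succ_pos (i : ℕ))
    simp only [Nat.succ_eq_add_one] at h2
    omega

theorem artinElt_isSymmetric {α : Fin n →₀ ℕ} (hα : IsDivisible α) :
    (artinElt F α).IsSymmetric := by
  refine Subalgebra.prod_mem (symmetricSubalgebra (Fin n) F) fun i _ => ?_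
  obtain ⟨b, hb⟩ := hα i
  rw [hb, Nat.mul_mod_right, pow_zero, mul_one]
  exact pow_mem (esymm_isSymmetric _ _ _) _

theorem artinMap_monomial_mul {α : Fin n →₀ ℕ} (hα : IsDivisible α) (f : MvPolynomial (Fin n) F) :
    artinMap F (monomial α 1 * f) = artinElt F α * artinMap F f := by
  have h : artinMap F ∘ₗ LinearMap.mulLeft F (monomial α (1 : F)) =
      LinearMap.mulLeft F (artinElt F α) ∘ₗ artinMap F := by
    refine (basisMonomials (Fin n) F).ext fun β => ?_
    rw [coe_basisMonomials, LinearMap.comp_apply, LinearMap.comp_apply, LinearMap.mulLeft_apply,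
      LinearMap.mulLeft_apply, monomial_mul, mul_one, artinMap_monomial, artinMap_monomial,
      artinElt_add F α β hα]
  exact LinearMap.congr_fun h f

theorem artinEquiv_symm_mul {α : Fin n →₀ ℕ} (hα : IsDivisible α) (f : MvPolynomial (Fin n) F) :
    (artinEquiv F).symm (artinElt F α * f) = monomial α 1 * (artinEquiv F).symm f := by
  rw [LinearEquiv.symm_apply_eq, artinEquiv_apply, artinMap_monomial_mul hα, ← artinEquiv_apply,
    LinearEquiv.apply_symm_apply]

/-- The diagonal coefficients of an operator in the basis of products of elementary symmetric
polynomials and reduced monomials. -/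
def artinDiag (T : Module.End F (MvPolynomial (Fin n) F)) (α : Fin n →₀ ℕ) : F :=
  coeff α ((artinEquiv F).symm (T (artinElt F α)))

/-- The operator commutes with the symmetric factor, which in Artin coordinates is a mere shift of
exponents. The diagonal coefficient therefore sees only the reduced part. -/
theorem artinDiag_add (q : F) (h : HeckeAlgebra q n) {α β : Fin n →₀ ℕ} (hα : IsDivisible α) :
    artinDiag (rho q n h) (α + β) = artinDiag (rho q n h) β := by
  rw [artinDiag, artinElt_add F α β hα, rho_symmetric_mul q h _ (artinElt_isSymmetric hα),
    artinEquiv_symm_mul hα, coeff_monomial_mul, one_mul, artinDiag]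

/-- Both sums are the trace on polynomials of degree d, in the monomial and in the Artin basis. -/
theorem sum_coeff_monomial_eq (q : F) (h : HeckeAlgebra q n) (d : ℕ) :
    ∑ α ∈ Finset.finsuppAntidiag (Finset.univ : Finset (Fin n)) d,
      coeff α (rho q n h (monomial α 1)) =
    ∑ α ∈ Finset.finsuppAntidiag (Finset.univ : Finset (Fin n)) d, artinDiag (rho q n h) α := by
  have h1 := trace_homogeneousSubmodule d (LinearEquiv.refl F _) (fun _ => Iff.rfl) (rho q n h)
    (rho_isHomogeneous q h d)
  have h2 := trace_homogeneousSubmodule d (artinEquiv F) (artinEquiv_isHomogeneous_iff d) (rho q n h)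
    (rho_isHomogeneous q h d)
  simp only [artinEquiv_apply, artinMap_monomial] at h2
  exact h1.symm.trans h2

/-- A non-reduced exponent has a nonzero divisible part, which gives a symmetric factor of positive
degree. -/
theorem artinElt_mem_coinvIdeal {α : Fin n →₀ ℕ} (hα : ¬IsReduced α) :
    artinElt F α ∈ coinvIdeal F n := by
  have h : α = (α - reducedPart α) + reducedPart α := (tsub_add_cancel_of_le (reducedPart_le α)).symm
  rw [h, artinElt_add F _ _ (isDivisible_sub_reducedPart α)]
  refine Ideal.mul_mem_right _ _ (Ideal.subset_span ⟨artinElt_isSymmetric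
    (isDivisible_sub_reducedPart α), ?_⟩)
  rw [constantCoeff_eq]
  refine (artinElt_isHomogeneous F _).coeff_eq_zero ?_
  rw [map_zero, ne_comm, Ne, Finsupp.degree_eq_zero_iff, ← isReduced_iff]
  exact hα

theorem isDivisible_esymmExponent (k : Fin n →₀ ℕ) : IsDivisible (esymmExponent k) :=
  fun _ => dvd_mul_right _ _

theorem coeff_artinEquiv_symm_mul_eq_zero {α e : Fin n →₀ ℕ} (hα : IsReduced α) (he : IsDivisible e)
    (h0 : e ≠ 0) (g : MvPolynomial (Fin n) F) :
    coeff α ((artinEquiv F).symm (artinElt F e * g)) = 0 := by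
  classical
  rw [artinEquiv_symm_mul he, coeff_monomial_mul', if_neg]
  intro hle
  apply h0
  ext i
  exact Nat.eq_zero_of_dvd_of_lt (he i) (lt_of_le_of_lt (hle i) (hα i))

/-- A symmetric polynomial without constant term is a polynomial in the e_k without constant term.
Each of its terms shifts exponents by a nonzero divisible vector, and a reduced exponent never
dominates such a vector. Hence the reduced coordinates descend to the coinvariant algebra. -/
theorem coeff_artinEquiv_symm_of_mem_coinvIdeal {α : Fin n →₀ ℕ} (hα : IsReduced α)
    {f : MvPolynomial (Fin n) F} (hf : f ∈ coinvIdeal F n) :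
    coeff α ((artinEquiv F).symm f) = 0 := by
  -- Allowing an arbitrary multiplier `g` lets the induction over the ideal absorb its polynomial
  -- coefficients.
  suffices h : ∀ g, coeff α ((artinEquiv F).symm (g * f)) = 0 by simpa using h 1
  rw [coinvIdeal, Ideal.span] at hf
  induction hf using Submodule.span_induction with
  | mem s hs =>
    intro g
    obtain ⟨hs, hc⟩ := hs
    obtain ⟨p, hp⟩ := esymmAlgHom_fin_surjective F (le_refl n) ⟨s, hs⟩
    have hp' := congrArg Subtype.val hp
    rw [esymmAlgHom_apply] at hp'
    simp only at hp'
    have hc0 : coeff 0 p = 0 := by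
      have hhom : constantCoeff.comp (aeval (R := F) fun i : Fin n =>
          esymm (Fin n) F ((i : ℕ) + 1)).toRingHom = constantCoeff := by
        refine ringHom_ext (fun r => by simp) fun i => ?_
        have h0 : coeff 0 (esymm (Fin n) F ((i : ℕ) + 1)) = 0 :=
          (esymm_isHomogeneous F _).coeff_eq_zero (by simp)
        simp [constantCoeff_eq, h0]
      have h1 := RingHom.congr_fun hhom p
      rw [RingHom.comp_apply] at h1
      rw [← constantCoeff_eq, ← h1, ← hc, ← hp']
      rfl
    rw [← hp', p.as_sum, map_sum, Finset.mul_sum, map_sum, coeff_sum]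
    refine Finset.sum_eq_zero fun k hk => ?_
    have hk0 : k ≠ 0 := by
      rintro rfl
      exact (mem_support_iff.1 hk) hc0
    rw [aeval_monomial, ← Algebra.smul_def, Finsupp.prod_fintype _ _ fun _ => pow_zero _,
      ← artinElt_esymmExponent, mul_comm, smul_mul_assoc, map_smul, coeff_smul,
      coeff_artinEquiv_symm_mul_eq_zero hα (isDivisible_esymmExponent k), smul_zero]
    intro h
    apply hk0
    ext i
    have := DFunLike.congr_fun h i
    simpa [esymmExponent] using this
  | zero => simp
  | add f f' _ _ hf hf' =>
    intro g
    rw [mul_add, map_add, coeff_add, hf, hf', add_zero]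
  | smul a f _ hf =>
    intro g
    rw [smul_eq_mul, ← mul_assoc]
    exact hf _

open Classical in
/-- The reduced exponents of degree `k`. -/
def reducedExponents (n k : ℕ) : Finset (Fin n →₀ ℕ) :=
  (Finset.finsuppAntidiag Finset.univ k).filter IsReduced

/-- The coefficient of a reduced monomial as a functional on the coinvariant algebra. -/
def coinvCoeff {α : Fin n →₀ ℕ} (hα : IsReduced α) : CoinvAlgebra F n →ₗ[F] F :=
  (((coinvIdeal F n).restrictScalars F).liftQ (lcoeff F α ∘ₗ (artinEquiv F).symm.toLinearMap)
    fun _ hf => coeff_artinEquiv_symm_of_mem_coinvIdeal hα hf) ∘ₗ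
      (Submodule.Quotient.restrictScalarsEquiv F (coinvIdeal F n)).symm.toLinearMap

theorem coinvCoeff_mk {α : Fin n →₀ ℕ} (hα : IsReduced α) (f : MvPolynomial (Fin n) F) :
    coinvCoeff hα (Ideal.Quotient.mk (coinvIdeal F n) f) = coeff α ((artinEquiv F).symm f) :=
  rfl

theorem artinEquiv_symm_artinElt (α : Fin n →₀ ℕ) :
    (artinEquiv F).symm (artinElt F α) = monomial α 1 := by
  rw [LinearEquiv.symm_apply_eq, artinEquiv_apply, artinMap_monomial]

theorem mk_artinElt_mem_coinvDeg {k : ℕ} {α : Fin n →₀ ℕ} (hα : α.degree = k) :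
    Ideal.Quotient.mk (coinvIdeal F n) (artinElt F α) ∈ coinvDeg F n k :=
  ⟨artinElt F α, hα ▸ artinElt_isHomogeneous F α, rfl⟩

open Classical in
theorem mem_reducedExponents {k : ℕ} {α : Fin n →₀ ℕ} :
    α ∈ reducedExponents n k ↔ α.degree = k ∧ IsReduced α := by
  rw [reducedExponents, Finset.mem_filter, mem_finsuppAntidiag_univ]

/-- Non-reduced products vanish in the quotient, so the reduced ones of degree k span R^k; the
functionals `coinvCoeff` are dual to them. -/
theorem chi_eq_sum (q : F) (k : ℕ) (h : HeckeAlgebra q n) :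
    chi q n k h = ∑ α ∈ reducedExponents n k, artinDiag (rho q n h) α := by
  classical
  rw [chi, ← Finset.sum_coe_sort]
  rw [trace_eq_sum_of_dual (ι := reducedExponents n k)
    (fun α => (⟨_, mk_artinElt_mem_coinvDeg (mem_reducedExponents.1 α.2).1⟩ : coinvDeg F n k))
    (fun α => coinvCoeff (mem_reducedExponents.1 α.2).2 ∘ₗ (coinvDeg F n k).subtype)]
  · rfl
  · intro α β
    rw [LinearMap.comp_apply, Submodule.subtype_apply, coinvCoeff_mk, artinEquiv_symm_artinElt,
      coeff_monomial]
    exact if_congr (by rw [Subtype.ext_iff, eq_comm]) rfl rfl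
  · rintro ⟨_, f, hf, rfl⟩ _
    have hg : ((artinEquiv F).symm f).IsHomogeneous k := by
      rw [← artinEquiv_isHomogeneous_iff, LinearEquiv.apply_symm_apply]
      exact hf
    have hmem := isHomogeneous_mem_span hg ((Submodule.span F (Set.range
      fun α : reducedExponents n k =>
        (⟨_, mk_artinElt_mem_coinvDeg (mem_reducedExponents.1 α.2).1⟩ : coinvDeg F n k))).map
          (coinvDeg F n k).subtype)
      ((Ideal.Quotient.mkₐ F (coinvIdeal F n)).toLinearMap ∘ₗ (artinEquiv F).toLinearMap)
      fun α hα => by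
        change Ideal.Quotient.mk (coinvIdeal F n) (artinMap F (monomial α 1)) ∈ _
        rw [artinMap_monomial]
        by_cases hr : IsReduced α
        · exact ⟨_, Submodule.subset_span ⟨⟨α, mem_reducedExponents.2 ⟨hα, hr⟩⟩, rfl⟩, rfl⟩
        · rw [Ideal.Quotient.eq_zero_iff_mem.2 (artinElt_mem_coinvIdeal hr)]
          exact zero_mem _
    obtain ⟨y, hy, he⟩ := hmem
    have hy' : y = ⟨_, f, hf, rfl⟩ := Subtype.ext (he.trans
      (congrArg (Ideal.Quotient.mk (coinvIdeal F n)) ((artinEquiv F).apply_symm_apply f)))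
    rwa [hy'] at hy

-- Every exponent is uniquely divisible plus reduced. The reduced parts give the characters, and the
-- divisible parts are counted by ∏ 1/(1 - t^(i+1)).
open Classical in
theorem mk_sum_artinDiag (q : F) (h : HeckeAlgebra q n) :
    (PowerSeries.mk fun d => ∑ α ∈ Finset.finsuppAntidiag (Finset.univ : Finset (Fin n)) d,
      artinDiag (rho q n h) α) =
      (PowerSeries.mk fun k => chi q n k h) * ∏ i : Fin n, stretch ((i : ℕ) + 1) fun _ => 1 := by
  ext d
  rw [PowerSeries.coeff_mk, PowerSeries.coeff_mul]
  simp only [PowerSeries.coeff_mk, PowerSeries.coeff_prod, chi_eq_sum, stretch, Finset.sum_mul_sum]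
  have hprod : ∀ l : Fin n →₀ ℕ, (∏ i : Fin n, if (i : ℕ) + 1 ∣ l i then (1 : F) else 0) =
      if IsDivisible l then 1 else 0 := by
    intro l
    by_cases hl : IsDivisible l
    · rw [if_pos hl, Finset.prod_eq_one fun i _ => if_pos (hl i)]
    · rw [if_neg hl]
      obtain ⟨i, hi⟩ := not_forall.1 hl
      exact Finset.prod_eq_zero (Finset.mem_univ i) (if_neg hi)
  simp only [hprod, mul_ite, mul_one, mul_zero, ← Finset.sum_filter]
  simp only [← Finset.sum_product']
  rw [Finset.sum_sigma']
  refine Finset.sum_bij' (fun α _ => ⟨((reducedPart α).degree, (α - reducedPart α).degree),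
    (reducedPart α, α - reducedPart α)⟩) (fun x _ => x.2.2 + x.2.1) ?_ ?_ ?_ ?_ ?_
  · intro α hα
    rw [mem_finsuppAntidiag_univ] at hα
    simp only [Finset.mem_sigma, Finset.mem_product, Finset.mem_filter,
      mem_reducedExponents, mem_finsuppAntidiag_univ, true_and]
    refine ⟨?_, isReduced_reducedPart α, isDivisible_sub_reducedPart α⟩
    rw [Finset.HasAntidiagonal.mem_antidiagonal, ← map_add, add_tsub_cancel_of_le (reducedPart_le α), hα]
  · rintro ⟨⟨k, e⟩, a, l⟩ hx
    simp only [Finset.mem_sigma, Finset.mem_product, Finset.mem_filter,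
      mem_reducedExponents, mem_finsuppAntidiag_univ] at hx ⊢
    rw [map_add, hx.2.1.1, hx.2.2.1, add_comm, Finset.HasAntidiagonal.mem_antidiagonal.1 hx.1]
  · intro α _
    exact tsub_add_cancel_of_le (reducedPart_le α)
  · rintro ⟨⟨k, e⟩, a, l⟩ hx
    simp only [Finset.mem_sigma, Finset.mem_product, Finset.mem_filter,
      mem_reducedExponents, mem_finsuppAntidiag_univ] at hx
    obtain ⟨_, ⟨rfl, ha⟩, rfl, hl⟩ := hx
    simp only [reducedPart_add hl ha, add_tsub_cancel_right]
  · intro α _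
    dsimp only
    conv_lhs => rw [← tsub_add_cancel_of_le (reducedPart_le α)]
    rw [artinDiag_add q h (isDivisible_sub_reducedPart α)]

end

/-! ### The character formula -/

section
variable {F : Type*} [Field F] {n : ℕ}

theorem rho_heckeTmu (q : F) (c : Composition n) :
    rho q n (heckeTmu q c) = (((List.finRange (n - 1)).filter fun i : Fin (n - 1) =>
      (i : ℕ) + 1 ∉ (Finset.Ico 1 c.length).image c.sizeUpTo).map (qComm q)).prod := by
  rw [heckeTmu, map_list_prod, List.map_map]
  congr 2
  funext i
  exact rho_heckeT q i

theorem mk_sum_coeff_monomial (q : F) (c : Composition n) :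
    (PowerSeries.mk fun d => ∑ α ∈ Finset.finsuppAntidiag (Finset.univ : Finset (Fin n)) d,
      coeff α (rho q n (heckeTmu q c) (monomial α 1))) =
      ∏ i : Fin c.length, PowerSeries.mk fun d =>
        ∑ α ∈ Finset.piAntidiag (Finset.univ : Finset (Fin (c.blocksFun i))) d, chainWeight q α := by
  rw [← mk_sum_prod_chainWeight]
  ext d
  rw [PowerSeries.coeff_mk, PowerSeries.coeff_mk, ← sum_finsuppAntidiag_univ d fun α =>
    ∏ i, chainWeight q fun a => α (c.blocksFinEquiv ⟨i, a⟩)]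
  refine Finset.sum_congr rfl fun α _ => ?_
  rw [rho_heckeTmu, coeff_qComm_prod q α _ ((List.pairwise_lt_finRange _).filter _),
    prod_blocks_chainWeight]

theorem prod_geom_mul (m : ℕ) :
    (∏ i ∈ Finset.range m, ∑ j ∈ Finset.range (i + 1), (PowerSeries.X : PowerSeries F) ^ j) *
      (1 - PowerSeries.X) ^ m = ∏ i ∈ Finset.range m, (1 - PowerSeries.X ^ (i + 1)) := by
  rw [← Finset.card_range m, ← Finset.prod_const, Finset.card_range, ← Finset.prod_mul_distrib]
  exact Finset.prod_congr rfl fun i _ => by rw [geom_sum_mul_neg]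

-- This is `sum_youngComponents` with φ = 1, multiplied by (1 - t)^n; the powers of 1 - t match
-- because the block sizes add up to n.
open Classical in
theorem sum_minimalRep_mul (c : Composition n) :
    (∑ r : Equiv.Perm (Fin n) with IsMinimalRep c r, (PowerSeries.X : PowerSeries F) ^ numInv r) *
      ∏ i : Fin c.length, ∏ j ∈ Finset.range (c.blocksFun i), (1 - PowerSeries.X ^ (j + 1)) =
      ∏ j ∈ Finset.range n, (1 - PowerSeries.X ^ (j + 1)) := by
  have h := sum_youngComponents c (PowerSeries.X : PowerSeries F) fun _ _ => 1
  simp only [Finset.prod_const_one, one_mul, sum_pow_numInv] at h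
  simp only [← prod_geom_mul, Finset.prod_mul_distrib, Finset.prod_pow_eq_pow_sum, c.sum_blocksFun]
  rw [h, mul_assoc]

theorem chi_heckeTmu (q : F) (c : Composition n) (k : ℕ) :
    chi q n k (heckeTmu q c) =
      ∑ w : Equiv.Perm (Fin n) with length w = k, weight q c w := by
  classical
  have h1 := mk_sum_coeff_monomial q c
  simp only [sum_coeff_monomial_eq, mk_sum_artinDiag] at h1
  have h2 : ∏ i : Fin n, ((1 - PowerSeries.X ^ ((i : ℕ) + 1)) *
      stretch ((i : ℕ) + 1) fun _ => (1 : F)) = 1 :=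
    Finset.prod_eq_one fun i _ => one_sub_mul_stretch_one (Nat.succ_pos _)
  -- Blocks are nonempty, so both product formulas apply with block size m + 1.
  have h3 : ∀ i : Fin c.length, (PowerSeries.mk fun d =>
      ∑ α ∈ Finset.piAntidiag (Finset.univ : Finset (Fin (c.blocksFun i))) d, chainWeight q α) *
        ∏ j ∈ Finset.range (c.blocksFun i), (1 - PowerSeries.X ^ (j + 1)) =
      ∑ v : Equiv.Perm (Fin (c.blocksFun i)),
        algebraMap F (PowerSeries F) (mq q v) * PowerSeries.X ^ numInv v := by
    intro i
    obtain ⟨m, hm⟩ := Nat.exists_eq_succ_of_ne_zero (Nat.one_le_iff_ne_zero.1 (c.one_le_blocksFun i))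
    rw [hm, mk_sum_chainWeight_mul, sum_mq_pow_numInv]
  have h4 := sum_youngComponents c (PowerSeries.X : PowerSeries F) fun i v =>
    algebraMap F (PowerSeries F) (mq q v)
  simp only [← h3, ← map_prod, Finset.prod_mul_distrib] at h4
  -- The product of the chain series is the graded trace, hence the character series times the
  -- `stretch` factors. The minimal representatives turn the block denominators into ∏ (1 -
  -- t^(i+1)), which cancels these factors.
  rw [← h1, mul_left_comm, sum_minimalRep_mul, mul_assoc, Finset.prod_range,
    mul_comm (∏ i : Fin n, stretch _ _), ← Finset.prod_mul_distrib, h2, mul_one] at h4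
  have h5 := congrArg (PowerSeries.coeff k) h4
  rw [PowerSeries.coeff_mk, map_sum] at h5
  rw [← h5, Finset.sum_filter]
  refine Finset.sum_congr rfl fun w _ => ?_
  rw [PowerSeries.algebraMap_apply, Algebra.algebraMap_self_apply, PowerSeries.coeff_C_mul,
    PowerSeries.coeff_X_pow, length_eq_numInv, weight]
  simp [eq_comm]

end

end HeckeCoinvariant

end

theorem theorem4p1 (n : ℕ) (μ : n.Partition) (k : ℕ) :
    HeckeCoinvariant.chi (RatFunc.X : RatFunc ℂ) n k
        (HeckeCoinvariant.heckeTmu RatFunc.X (HeckeCoinvariant.blocksOf μ)) =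
      ∑ w : Equiv.Perm (Fin n) with HeckeCoinvariant.length w = k,
        HeckeCoinvariant.weight (RatFunc.X : RatFunc ℂ) (HeckeCoinvariant.blocksOf μ) w :=
  HeckeCoinvariant.chi_heckeTmu _ _ _
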